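/- Planar trees are rooted plane trees $T$, finite or infinite, in which every vertex has finitely many (ordered) offspring and the root has exactly one offspring. Let $D_r(T)$ be the set of vertices at distance $r$ from the root, $h(T)$ the height and $|T|$ the number of edges of $T$, and $B_r(T)$ the subtree spanned by the vertices at distance at most $r$ from the root. Let $\mathcal T$ be the space of planar trees, with the metric $\mathrm{dist}(T,T')=\inf\{1/r : r\in\mathbb N,\ B_r(T)=B_r(T')\}$ (with $\mathbb N=\{1,2,\dots\}$), closed balls $\mathcal B_a(T)$, and its Borel $\sigma$-algebra. For $\mu\in\mathbb R$ and $N\ge 1$ let $\nu^{(\mu)}_N$ be the probability measure on $\mathcal T$ supported on the trees of size $|T|=N$ with $\nu^{(\mu)}_N(\{T\})=e^{-\mu h(T)}/Z^{(\mu)}_N$, where $Z^{(\mu)}_N=\sum_{|T|=N}e^{-\mu h(T)}$. Let $X(g)=\sum_{T\ \mathrm{finite}}g^{|T|}$ and $g_c(k)=k/(1+k)^2$. For a subcritical offspring distribution $p$ on $\{0,1,2,\dots\}$ with mean $m=\sum_n n\,p(n)$, put $p^*(n)=(n+1)p(n+1)/m$ and $p^s(n)=p^*(n)/(n+1)=p(n+1)/m$.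 The associated Kesten (size-biased) BGW tree is the Borel probability measure $\hat\lambda$ on $\mathcal T$, supported on infinite trees, such that for every finite tree $T_0$, with $r=h(T_0)$, $$\hat\lambda\big(\mathcal B_{1/r}(T_0)\big)=\sum_{i\in D_r(T_0)}\ \prod_{v}p(\sigma(v)-1)\ \prod_{w}p^s(\sigma(w)-2),$$ where $\sigma$ denotes the degree in $T_0$, $w$ runs over the vertices at heights $1,\dots,r-1$ on the path from the root to $i$, and $v$ runs over the other vertices at heights $1,\dots,r-1$. **Proposition.** Let $\mu<0$ and $k=e^{-\mu}>1$. Then the series $X(g_c(k))$ converges, and $$p(n)=X(g_c(k))^n\,\big(1-X(g_c(k))\big),\qquad n=0,1,2,\dots,$$ is a probability distribution with mean less than $1$. The measures $\nu^{(\mu)}_N$ converge weakly, as $N\to\infty$, to a Borel probability measure $\nu^{(\mu)}$ on $\mathcal T$, and $\nu^{(\mu)}$ equals the measure $\hat\lambda$ associated to $p$, which exists and is unique. Moreover, $\nu^{(\mu)}$-almost every tree has a single spine: at each height it has exactly one vertex with infinitely many descendants. -/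

import Mathlib

open MeasureTheory Filter Topology

noncomputable section

/-- A rooted planar tree, given by its set of vertices in Ulam--Harris notation. A vertex is the
finite word that records the positions (from the left, counted from `0`) of its ancestors among
their siblings; the parent of `u ++ [i]` is `u`, and the offspring of `u` is ordered by `i`.
The root `[]` has exactly one offspring `[0]`, and every vertex has finitely many offspring. -/
@[ext] structure PlaneTree where
  carrier : Set (List ℕ)
  nil_mem : [] ∈ carrier
  root_edge : ∀ j, [j] ∈ carrier ↔ j = 0
  parent_mem : ∀ u i, u ++ [i] ∈ carrier → u ∈ carrier
  left_sibling_mem : ∀ u i j, j ≤ i → u ++ [i] ∈ carrier → u ++ [j] ∈ carrier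
  offspring_finite : ∀ u, {i | u ++ [i] ∈ carrier}.Finite

namespace PlaneTree

/-- The set `D_r` of vertices at height `r`. -/
def level (T : PlaneTree) (r : ℕ) : Set (List ℕ) := {u | u ∈ T.carrier ∧ u.length = r}

/-- The set of vertices of the ball `B_r(T)` around the root. In Ulam--Harris notation a subtree
containing the root is determined by its set of vertices. -/
def ballVerts (T : PlaneTree) (r : ℕ) : Set (List ℕ) := {u | u ∈ T.carrier ∧ u.length ≤ r}

/-- The number of offspring of `v`, that is, the degree `σ(v)` minus one if `v` is a vertex
different from the root. -/
def offspring (T : PlaneTree) (v : List ℕ) : ℕ := {i | v ++ [i] ∈ T.carrier}.ncard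

/-- The tree has finitely many vertices. -/
def IsFinite (T : PlaneTree) : Prop := T.carrier.Finite

/-- The size `|T|` of a finite tree: its number of edges. Each edge joins a vertex different from
the root to the parent of that vertex. -/
def size (T : PlaneTree) : ℕ := (T.carrier \ {[]}).ncard

/-- The height of a finite tree: the largest `r` such that `D_r` is not empty. -/
def height (T : PlaneTree) : ℕ := sSup {r | (T.level r).Nonempty}

/-- The vertex `u` of `T` is of infinite type: it has infinitely many descendants. -/
def IsInfiniteType (T : PlaneTree) (u : List ℕ) : Prop :=
  {w | w ∈ T.carrier ∧ u <+: w}.Infinite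

/-- The tree has a single spine: its vertices of infinite type form one infinite path from the
root, that is, there is exactly one of them at each height. -/
def HasSingleSpine (T : PlaneTree) : Prop :=
  ∀ r, ∃! u, u ∈ T.level r ∧ T.IsInfiniteType u

theorem level_finite (T : PlaneTree) (r : ℕ) : (T.level r).Finite := by
  induction r with
  | zero =>
    refine (Set.finite_singleton ([] : List ℕ)).subset ?_
    rintro u ⟨-, hu⟩
    simpa using hu
  | succ r ih =>
    refine (ih.biUnion (fun u _ => (T.offspring_finite u).image (fun i => u ++ [i]))).subset ?_
    rintro w ⟨hw, hl⟩
    rcases List.eq_nil_or_concat' w with rfl | ⟨u, i, rfl⟩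
    · simp at hl
    · have hl' : u.length = r := by simpa using hl
      simp only [Set.mem_iUnion]
      exact ⟨u, ⟨T.parent_mem u i hw, hl'⟩, i, hw, rfl⟩

/-- The set `D_r` as a `Finset`. -/
def levelFinset (T : PlaneTree) (r : ℕ) : Finset (List ℕ) := (T.level_finite r).toFinset

/-- The vertices at heights `1, …, r - 1`, as a `Finset`. -/
def innerVerts (T : PlaneTree) (r : ℕ) : Finset (List ℕ) :=
  (Finset.Ico 1 r).biUnion T.levelFinset

/-! ### The metric -/

/-- The radii `1 / r` of the balls around the root that two trees have in common. -/
def commonRadii (T T' : PlaneTree) : Set ℝ :=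
  {a | ∃ r : ℕ, 1 ≤ r ∧ T.ballVerts r = T'.ballVerts r ∧ a = 1 / (r : ℝ)}

theorem ballVerts_one (T : PlaneTree) : T.ballVerts 1 = {[], [0]} := by
  ext u
  simp only [ballVerts, Set.mem_ofPred_eq, Set.mem_insert_iff, Set.mem_singleton_iff]
  constructor
  · rintro ⟨hu, hl⟩
    match u, hu, hl with
    | [], _, _ => exact Or.inl rfl
    | [j], hu, _ => exact Or.inr (by rw [(T.root_edge j).1 hu])
    | _ :: _ :: _, _, hl => simp at hl
  · rintro (rfl | rfl)
    · exact ⟨T.nil_mem, by simp⟩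
    · exact ⟨(T.root_edge 0).2 rfl, by simp⟩

theorem ballVerts_mono_eq {T T' : PlaneTree} {r s : ℕ} (h : T.ballVerts s = T'.ballVerts s)
    (hrs : r ≤ s) : T.ballVerts r = T'.ballVerts r := by
  ext u
  have hu := Set.ext_iff.1 h u
  simp only [ballVerts, Set.mem_ofPred_eq] at hu ⊢
  constructor
  · rintro ⟨h1, h2⟩
    exact ⟨(hu.1 ⟨h1, h2.trans hrs⟩).1, h2⟩
  · rintro ⟨h1, h2⟩
    exact ⟨(hu.2 ⟨h1, h2.trans hrs⟩).1, h2⟩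

theorem commonRadii_nonempty (T T' : PlaneTree) : (commonRadii T T').Nonempty :=
  ⟨1 / ((1 : ℕ) : ℝ), 1, le_rfl, by rw [ballVerts_one, ballVerts_one], rfl⟩

theorem commonRadii_nonneg (T T' : PlaneTree) : ∀ a ∈ commonRadii T T', 0 ≤ a := by
  rintro a ⟨r, -, -, rfl⟩
  positivity

theorem commonRadii_bddBelow (T T' : PlaneTree) : BddBelow (commonRadii T T') :=
  ⟨0, fun a ha => commonRadii_nonneg T T' a ha⟩

/-- The distance `dist(T, T') = inf {1 / r | B_r(T) = B_r(T')}`. -/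
instance : Dist PlaneTree := ⟨fun T T' => sInf (commonRadii T T')⟩

theorem dist_def (T T' : PlaneTree) : dist T T' = sInf (commonRadii T T') := rfl

theorem dist_self' (T : PlaneTree) : dist T T = 0 := by
  refine le_antisymm ?_ (le_csInf (commonRadii_nonempty T T) (commonRadii_nonneg T T))
  refine le_of_forall_pos_le_add fun ε hε => ?_
  obtain ⟨n, hn⟩ := exists_nat_one_div_lt hε
  have h : dist T T ≤ 1 / ((n + 1 : ℕ) : ℝ) :=
    csInf_le (commonRadii_bddBelow T T) ⟨n + 1, by omega, rfl, rfl⟩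
  push_cast at h
  linarith

theorem dist_comm' (T T' : PlaneTree) : dist T T' = dist T' T := by
  have : commonRadii T T' = commonRadii T' T := by
    ext a
    simp only [commonRadii, Set.mem_ofPred_eq, eq_comm]
  rw [dist_def, dist_def, this]

theorem dist_triangle' (T T' T'' : PlaneTree) : dist T T'' ≤ dist T T' + dist T' T'' := by
  refine le_of_forall_pos_lt_add fun ε hε => ?_
  obtain ⟨a, ⟨r, hr, hrT, rfl⟩, ha⟩ :=
    exists_lt_of_csInf_lt (commonRadii_nonempty T T') (lt_add_of_pos_right _ (half_pos hε))
  obtain ⟨b, ⟨s, hs, hsT, rfl⟩, hb⟩ :=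
    exists_lt_of_csInf_lt (commonRadii_nonempty T' T'') (lt_add_of_pos_right _ (half_pos hε))
  rw [← dist_def] at ha hb
  have hr0 : (0 : ℝ) < 1 / (r : ℝ) := by positivity
  have hs0 : (0 : ℝ) < 1 / (s : ℝ) := by positivity
  rcases le_total r s with h | h
  · have : dist T T'' ≤ 1 / (r : ℝ) :=
      csInf_le (commonRadii_bddBelow T T'') ⟨r, hr, hrT.trans (ballVerts_mono_eq hsT h), rfl⟩
    linarith
  · have : dist T T'' ≤ 1 / (s : ℝ) :=
      csInf_le (commonRadii_bddBelow T T'') ⟨s, hs, (ballVerts_mono_eq hrT h).trans hsT, rfl⟩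
    linarith

theorem ballVerts_eq_of_dist_lt {T T' : PlaneTree} {n : ℕ} (hn : 1 ≤ n)
    (h : dist T T' < 1 / (n : ℝ)) : T.ballVerts n = T'.ballVerts n := by
  obtain ⟨a, ⟨r, hr, hrT, rfl⟩, ha⟩ := exists_lt_of_csInf_lt (commonRadii_nonempty T T') h
  refine ballVerts_mono_eq hrT ?_
  have hr0 : (0 : ℝ) < r := by exact_mod_cast hr
  have hn0 : (0 : ℝ) < n := by exact_mod_cast hn
  have := (one_div_lt_one_div hr0 hn0).1 ha
  exact_mod_cast this.le

theorem eq_of_dist_eq_zero' {T T' : PlaneTree} (h : dist T T' = 0) : T = T' := by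
  have key : ∀ n : ℕ, T.ballVerts (n + 1) = T'.ballVerts (n + 1) := fun n =>
    ballVerts_eq_of_dist_lt (by omega) (by rw [h]; positivity)
  ext u
  have hu := Set.ext_iff.1 (key u.length) u
  simpa [ballVerts] using hu

instance : MetricSpace PlaneTree where
  dist_self := dist_self'
  dist_comm := dist_comm'
  dist_triangle := dist_triangle'
  eq_of_dist_eq_zero := eq_of_dist_eq_zero'

instance : MeasurableSpace PlaneTree := borel PlaneTree

instance : BorelSpace PlaneTree := ⟨rfl⟩

/-! ### The finite size measures -/

theorem prefix_mem (T : PlaneTree) (u w : List ℕ) (h : u ++ w ∈ T.carrier) : u ∈ T.carrier := by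
  induction w using List.reverseRecOn with
  | nil => simpa using h
  | append_singleton w i ih =>
    rw [← List.append_assoc] at h
    exact ih (T.parent_mem _ _ h)

theorem length_le_of_mem {T : PlaneTree} {N : ℕ} (hf : T.carrier.Finite) (hN : T.size = N)
    {u : List ℕ} (hu : u ∈ T.carrier) : u.length ≤ N := by
  have hsub : (fun n => u.take (n + 1)) '' (Set.Iio u.length) ⊆ T.carrier \ {[]} := by
    rintro w ⟨n, hn, rfl⟩
    have hn' : n < u.length := hn
    refine ⟨T.prefix_mem _ (u.drop (n + 1)) (by simpa using hu), ?_⟩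
    intro h
    have := congrArg List.length (show u.take (n + 1) = [] from h)
    simp at this
    subst this
    simp at hn'
  have hinj : Set.InjOn (fun n => u.take (n + 1)) (Set.Iio u.length) := by
    intro a ha b hb hab
    have ha' : a < u.length := ha
    have hb' : b < u.length := hb
    have := congrArg List.length hab
    simp only [List.length_take] at this
    omega
  have h1 := Set.ncard_le_ncard hsub (hf.subset Set.sdiff_subset)
  rw [hinj.ncard_image] at h1
  simpa [size, ← hN, Set.ncard_eq_toFinset_card'] using h1

theorem label_lt_of_mem {T : PlaneTree} {N : ℕ} (hf : T.carrier.Finite) (hN : T.size = N)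
    {u : List ℕ} {i : ℕ} (hu : u ++ [i] ∈ T.carrier) : i < N := by
  have hsub : (fun n => u ++ [n]) '' (Set.Iic i) ⊆ T.carrier \ {[]} := by
    rintro w ⟨n, hn, rfl⟩
    exact ⟨T.left_sibling_mem u i n hn hu, by simp⟩
  have hinj : Set.InjOn (fun n => u ++ [n]) (Set.Iic i) := by
    intro a _ b _ hab
    simpa using hab
  have h1 := Set.ncard_le_ncard hsub (hf.subset Set.sdiff_subset)
  rw [hinj.ncard_image] at h1
  have h2 : (Set.Iic i).ncard = i + 1 := by simp [Set.ncard_eq_toFinset_card']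
  rw [h2] at h1
  have h3 : i + 1 ≤ N := hN ▸ h1
  omega

theorem labels_lt_of_mem {T : PlaneTree} {N : ℕ} (hf : T.carrier.Finite) (hN : T.size = N)
    {u : List ℕ} (hu : u ∈ T.carrier) : ∀ i ∈ u, i < N := by
  intro i hi
  obtain ⟨s, t, rfl⟩ := List.append_of_mem hi
  refine label_lt_of_mem hf hN (T.prefix_mem (s ++ [i]) t ?_)
  simpa using hu

theorem finite_setOf_size (N : ℕ) : {T : PlaneTree | T.IsFinite ∧ T.size = N}.Finite := by
  have hfin : {u : List ℕ | u.length ≤ N ∧ ∀ i ∈ u, i < N}.Finite := by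
    refine ((List.finite_length_le (Fin N) N).image (List.map Fin.val)).subset ?_
    rintro u ⟨hl, hu⟩
    refine ⟨u.pmap (fun i h => (⟨i, h⟩ : Fin N)) hu, by simpa using hl, ?_⟩
    simp [List.map_pmap]
  refine Set.Finite.of_finite_image (f := PlaneTree.carrier) (hfin.finite_subsets.subset ?_) ?_
  · rintro _ ⟨T, ⟨hf, hN⟩, rfl⟩ u hu
    exact ⟨length_le_of_mem hf hN hu, labels_lt_of_mem hf hN hu⟩
  · intro T _ T' _ h
    exact PlaneTree.ext h

/-- The finite set of planar trees of size `N`. -/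
def treesOfSize (N : ℕ) : Finset PlaneTree := (finite_setOf_size N).toFinset

/-- The linear tree of size `N + 1`. -/
def linearTree (N : ℕ) : PlaneTree where
  carrier := {u | ∃ n ≤ N + 1, u = List.replicate n 0}
  nil_mem := ⟨0, by omega, rfl⟩
  root_edge j := by
    constructor
    · rintro ⟨n, -, h⟩
      exact List.eq_of_mem_replicate (h ▸ List.mem_singleton_self j)
    · rintro rfl
      exact ⟨1, by omega, rfl⟩
  parent_mem := by
    rintro u i ⟨n, hn, h⟩
    refine ⟨u.length, ?_, ?_⟩
    · have := congrArg List.length h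
      simp at this
      omega
    · refine List.eq_replicate_iff.2 ⟨rfl, fun b hb => ?_⟩
      exact List.eq_of_mem_replicate (h ▸ List.mem_append_left [i] hb)
  left_sibling_mem := by
    rintro u i j hj ⟨n, hn, h⟩
    have hi : i = 0 := List.eq_of_mem_replicate (h ▸ (by simp : i ∈ u ++ [i]))
    have : j = i := by omega
    exact ⟨n, hn, this ▸ h⟩
  offspring_finite := by
    intro u
    refine (Set.finite_singleton 0).subset ?_
    rintro i ⟨n, -, h⟩
    exact List.eq_of_mem_replicate (h ▸ (by simp : i ∈ u ++ [i]))

theorem linearTree_mem (N : ℕ) : linearTree N ∈ treesOfSize (N + 1) := by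
  have hc : (linearTree N).carrier = (fun n => List.replicate n 0) '' Set.Iic (N + 1) := by
    ext u
    simp [linearTree, eq_comm]
  have hd : (linearTree N).carrier \ {[]} =
      (fun n => List.replicate n 0) '' Set.Icc 1 (N + 1) := by
    rw [hc]
    ext u
    constructor
    · rintro ⟨⟨n, hn, rfl⟩, h⟩
      refine ⟨n, ⟨?_, hn⟩, rfl⟩
      by_contra h0
      have : n = 0 := by omega
      subst this
      exact h rfl
    · rintro ⟨n, ⟨h1, hn⟩, rfl⟩
      refine ⟨⟨n, hn, rfl⟩, fun h => ?_⟩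
      have := congrArg List.length (show List.replicate n 0 = [] from h)
      simp at this
      omega
  simp only [treesOfSize, Set.Finite.mem_toFinset, Set.mem_ofPred_eq]
  refine ⟨?_, ?_⟩
  · rw [IsFinite, hc]
    exact (Set.finite_Iic _).image _
  · rw [size, hd, Set.ncard_image_of_injective _ (List.replicate_left_injective 0)]
    simp [Set.ncard_eq_toFinset_card']

/-- The finite size partition function `Z_N = ∑ exp (- μ h(T))`, summed over the trees of
size `N`. -/
def partitionFunction (μ : ℝ) (N : ℕ) : ℝ :=
  ∑ T ∈ treesOfSize N, Real.exp (-μ * T.height)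

/-- The measure on the space of planar trees that is supported on the trees of size `N` and gives
mass `exp (- μ h(T)) / Z_N` to each such tree `T`. -/
def finiteSizeMeasure (μ : ℝ) (N : ℕ) : Measure PlaneTree :=
  ∑ T ∈ treesOfSize N,
    ENNReal.ofReal (Real.exp (-μ * T.height) / partitionFunction μ N) • Measure.dirac T

theorem isProbabilityMeasure_finiteSizeMeasure (μ : ℝ) (N : ℕ+) :
    IsProbabilityMeasure (finiteSizeMeasure μ N) := by
  have hpos : 0 < partitionFunction μ N := by
    refine Finset.sum_pos (fun T _ => Real.exp_pos _) ⟨linearTree (N.natPred), ?_⟩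
    have := linearTree_mem N.natPred
    rwa [PNat.natPred_add_one] at this
  constructor
  simp only [finiteSizeMeasure, Measure.coe_finsetSum, Finset.sum_apply, Measure.smul_apply,
    measure_univ, smul_eq_mul, mul_one]
  rw [← ENNReal.ofReal_sum_of_nonneg (fun T _ => by positivity), ← Finset.sum_div]
  rw [show ∑ T ∈ treesOfSize (N : ℕ), Real.exp (-μ * T.height) = partitionFunction μ N from rfl,
    div_self hpos.ne', ENNReal.ofReal_one]

/-- The measure `finiteSizeMeasure μ N` for `N = 1, 2, 3, …`, as a probability measure. -/
def finiteSizeLaw (μ : ℝ) (N : ℕ+) : ProbabilityMeasure PlaneTree :=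
  ⟨finiteSizeMeasure μ N, isProbabilityMeasure_finiteSizeMeasure μ N⟩

/-! ### The offspring probabilities and the BGW tree with a special line of descent -/

/-- The generating function `X(g) = ∑ g ^ |T|`, summed over all finite planar trees. -/
def treeSeries (g : ℝ) : ℝ := ∑' T : {T : PlaneTree // T.IsFinite}, g ^ T.1.size

/-- The critical point `g_c(k) = k / (1 + k) ^ 2`. -/
def criticalPoint (k : ℝ) : ℝ := k / (1 + k) ^ 2

/-- The offspring probabilities `p(n) = X(g_c(k)) ^ n (1 - X(g_c(k)))`. -/
def branchingProb (k : ℝ) (n : ℕ) : ℝ :=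
  treeSeries (criticalPoint k) ^ n * (1 - treeSeries (criticalPoint k))

/-- The average offspring `m = ∑ n p(n)`. -/
def meanOffspring (p : ℕ → ℝ) : ℝ := ∑' n : ℕ, (n : ℝ) * p n

/-- `p` is a subcritical offspring probability distribution. -/
structure IsSubcritical (p : ℕ → ℝ) : Prop where
  nonneg : ∀ n, 0 ≤ p n
  hasSum_one : HasSum p 1
  summable_mean : Summable fun n : ℕ => (n : ℝ) * p n
  mean_lt_one : meanOffspring p < 1

/-- The distribution `p*(n) = (n + 1) p(n + 1) / m` of the number of normal offspring of a special
individual. -/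
def sizeBiased (p : ℕ → ℝ) (n : ℕ) : ℝ := ((n : ℝ) + 1) * p (n + 1) / meanOffspring p

/-- The probability `p^s(n) = p*(n) / (n + 1)` that a special individual has `n + 1` offspring
and that the special one among them has a given position. -/
def specialProb (p : ℕ → ℝ) (n : ℕ) : ℝ := sizeBiased p n / ((n : ℝ) + 1)

/-- The probability that the tree agrees with `T₀` up to height `r = h(T₀)` and that the special
vertices up to height `r` are those on the path `ω(i)` from the vertex next to the root to the
vertex `i` at height `r`. The vertices at heights `1, …, r - 1` on this path are those that are
prefixes of `i`; such a vertex has `σ(v) - 1 ≥ 1` offspring, one of which is special. -/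
def markedWeight (p : ℕ → ℝ) (T₀ : PlaneTree) (i : List ℕ) : ℝ :=
  (∏ v ∈ T₀.innerVerts T₀.height with ¬ v <+: i, p (T₀.offspring v)) *
    ∏ v ∈ T₀.innerVerts T₀.height with v <+: i, specialProb p (T₀.offspring v - 1)

/-- `lam` is the law of the BGW tree with special and normal individuals (Kesten's size-biased
tree) associated to the offspring probabilities `p`: it is supported on the infinite trees, and
the value on the ball of radius `1 / r` around a finite tree `T₀` of height `r` is the sum of the
weights of all possible special paths in `T₀`. -/
structure IsKestenLaw (p : ℕ → ℝ) (lam : ProbabilityMeasure PlaneTree) : Prop where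
  ae_infinite : ∀ᵐ T ∂(lam : Measure PlaneTree), ¬ T.IsFinite
  measure_ball : ∀ T₀ : PlaneTree, T₀.IsFinite →
    (lam : Measure PlaneTree).real (Metric.closedBall T₀ (1 / (T₀.height : ℝ))) =
      ∑ i ∈ T₀.levelFinset T₀.height, markedWeight p T₀ i

end PlaneTree

end

/-!
A finite tree is either a single edge or the join of the leftmost branch `L` of the vertex next to
the root with the remaining tree `R`. Hence `X = g + X ^ 2`, and the partial sums of `X (g_c k)`
stay below the smaller root `1 / (1 + k)` of this equation, so `p` is geometric with mean `1 / k`.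

The generating series `A m` of the trees of height at most `m` satisfy
`A (m + 1) = g + A m * A (m + 1)`. With `Δ m = A (m + 1) - A m` this gives
`g (Δ m + 2 Δ (m + 1) + Δ (m + 2)) = Δ (m + 1) (1 + Δ m + Δ (m + 1) + Δ (m + 2))`.
All coefficients are nonnegative, so the left side dominates `Δ (m + 1)`, whence
`g_c k * Z (N + 1) ≤ Z N`. This one-sided inequality replaces the asymptotics of `Z N`.
For a finite tree `T₀` of height `r`, extend `T₀` by a large branch above one vertex `i` at height
`r` and by branches of size at most `M` above the others. Different `i` give disjoint families of
trees of size `N`, whose heights are at least `r - 1` plus that of the large branch. Letting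
`N → ∞` and then `M → ∞`, the lower limit of `ν_N` on the ball of radius `1 / r` around `T₀` is at
least the Kesten mass of that ball.

No upper bound is needed: an open set contains disjoint balls of this kind that cover its infinite
trees, and a Kesten law has all its mass on infinite trees, so the lower bounds already give the
portmanteau condition on open sets. Applied to a constant sequence, the same argument shows that
the Kesten law is unique. Its existence follows by building the tree from independent variables
attached to all words. Off the special path, the expected number of descendants of a vertex is
`∑ n, m ^ n < ∞`, so almost surely only the special vertices have infinitely many descendants.
-/

noncomputable section

namespace PlaneTree

/-! ### Trees given by their offspring numbers -/

/-- The word `w` is a vertex of the tree in which every vertex `v` has `o v` offspring. -/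
def InTree : (List ℕ → ℕ) → List ℕ → Prop
  | _, [] => True
  | o, j :: w => j < o [] ∧ InTree (fun v => o (j :: v)) w

@[simp] theorem inTree_nil (o : List ℕ → ℕ) : InTree o [] := trivial

@[simp] theorem inTree_cons (o : List ℕ → ℕ) (j : ℕ) (w : List ℕ) :
    InTree o (j :: w) ↔ j < o [] ∧ InTree (fun v => o (j :: v)) w := Iff.rfl

theorem inTree_append (o : List ℕ → ℕ) (u w : List ℕ) :
    InTree o (u ++ w) ↔ InTree o u ∧ InTree (fun v => o (u ++ v)) w := by
  induction u generalizing o with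
  | nil => simp
  | cons j u ih => simp [ih, and_assoc]

theorem inTree_append_singleton (o : List ℕ → ℕ) (u : List ℕ) (i : ℕ) :
    InTree o (u ++ [i]) ↔ InTree o u ∧ i < o u := by
  simp [inTree_append]

theorem InTree.congr {o o' : List ℕ → ℕ} {w : List ℕ} (hw : InTree o w)
    (h : ∀ v, v.length < w.length → InTree o v → o v = o' v) : InTree o' w := by
  induction w using List.reverseRecOn with
  | nil => trivial
  | append_singleton w i ih =>
    rw [inTree_append_singleton] at hw ⊢
    refine ⟨ih hw.1 fun v hv => h v (by simpa using hv.trans (Nat.lt_succ_self _)), ?_⟩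
    rw [← h w (by simp) hw.1]
    exact hw.2

/-- The planar tree in which every vertex `v` has `o v` offspring. -/
def ofOffspring (o : List ℕ → ℕ) (ho : o [] = 1) : PlaneTree where
  carrier := {w | InTree o w}
  nil_mem := trivial
  root_edge j := by simp [ho]
  parent_mem u i h := ((inTree_append_singleton o u i).1 h).1
  left_sibling_mem u i j hj h := by
    have ⟨hu, hi⟩ := (inTree_append_singleton o u i).1 h
    exact (inTree_append_singleton o u j).2 ⟨hu, hj.trans_lt hi⟩
  offspring_finite u := (Set.finite_Iio (o u)).subset fun i h =>
    ((inTree_append_singleton o u i).1 h).2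

theorem mem_ofOffspring {o : List ℕ → ℕ} {ho : o [] = 1} {w : List ℕ} :
    w ∈ (ofOffspring o ho).carrier ↔ InTree o w := Iff.rfl

theorem append_singleton_mem_iff (T : PlaneTree) (v : List ℕ) (i : ℕ) :
    v ++ [i] ∈ T.carrier ↔ i < T.offspring v := by
  have hlower : IsLowerSet {i | v ++ [i] ∈ T.carrier} := fun i j hj hi =>
    T.left_sibling_mem v i j hj hi
  obtain ⟨n, hn⟩ := hlower.eq_univ_or_Iio.resolve_left
    fun h => Set.infinite_univ (h ▸ T.offspring_finite v)
  rw [offspring, hn, Set.ncard_Iio_nat]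
  exact Set.ext_iff.1 hn i

theorem mem_iff_inTree (T : PlaneTree) (w : List ℕ) :
    w ∈ T.carrier ↔ InTree T.offspring w := by
  induction w using List.reverseRecOn with
  | nil => exact iff_of_true T.nil_mem trivial
  | append_singleton w i ih =>
    rw [inTree_append_singleton, ← ih, ← append_singleton_mem_iff]
    exact ⟨fun h => ⟨T.parent_mem w i h, h⟩, fun h => h.2⟩

theorem offspring_ofOffspring {o : List ℕ → ℕ} {ho : o [] = 1} {v : List ℕ}
    (hv : InTree o v) : (ofOffspring o ho).offspring v = o v :=
  eq_of_forall_lt_iff fun i => by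
    rw [← append_singleton_mem_iff, mem_ofOffspring, inTree_append_singleton, and_iff_right hv]

theorem offspring_nil (T : PlaneTree) : T.offspring [] = 1 :=
  eq_of_forall_lt_iff fun i => by
    rw [← append_singleton_mem_iff, Nat.lt_one_iff]
    exact T.root_edge i

theorem zero_mem (T : PlaneTree) : [0] ∈ T.carrier := (T.root_edge 0).2 rfl

theorem eq_zero_of_cons_mem {T : PlaneTree} {j : ℕ} {w : List ℕ} (h : j :: w ∈ T.carrier) :
    j = 0 := (T.root_edge j).1 (T.prefix_mem [j] w h)

theorem offspring_eq_of_ballVerts_eq {T T' : PlaneTree} {r : ℕ}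
    (h : T.ballVerts r = T'.ballVerts r) {v : List ℕ} (hv : v.length < r) :
    T.offspring v = T'.offspring v :=
  eq_of_forall_lt_iff fun i => by
    have hlen : (v ++ [i]).length ≤ r := by simpa using hv
    simpa only [ballVerts, Set.mem_ofPred_eq, hlen, and_true, append_singleton_mem_iff]
      using Set.ext_iff.1 h (v ++ [i])

theorem ballVerts_eq_iff (T T' : PlaneTree) (r : ℕ) :
    T.ballVerts r = T'.ballVerts r ↔
      ∀ v ∈ T'.carrier, v.length < r → T.offspring v = T'.offspring v := by
  refine ⟨fun h v _ hv => offspring_eq_of_ballVerts_eq h hv, fun h => ?_⟩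
  have mem_iff (w : List ℕ) (hw : w.length ≤ r) : w ∈ T.carrier ↔ w ∈ T'.carrier := by
    induction w using List.reverseRecOn with
    | nil => exact iff_of_true T.nil_mem T'.nil_mem
    | append_singleton w i ih =>
      have hwr : w.length < r := by simpa using hw
      rw [mem_iff_inTree, mem_iff_inTree, inTree_append_singleton, inTree_append_singleton,
        ← mem_iff_inTree, ← mem_iff_inTree, ih hwr.le]
      exact and_congr_right fun hw' => by rw [h w hw' hwr]
  ext w
  exact and_congr_left fun hw => mem_iff w hw

/-! ### Size and height of finite trees -/

/-- The vertices of `T` other than the root, each written as the path to it from the vertex `[0]`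
next to the root. In these coordinates the decomposition of a tree is a disjoint union. -/
def aboveRoot (T : PlaneTree) : Set (List ℕ) := {w | 0 :: w ∈ T.carrier}

theorem mem_aboveRoot {T : PlaneTree} {w : List ℕ} : w ∈ T.aboveRoot ↔ 0 :: w ∈ T.carrier := Iff.rfl

theorem nil_mem_aboveRoot (T : PlaneTree) : [] ∈ T.aboveRoot := T.zero_mem

theorem image_cons_aboveRoot (T : PlaneTree) : List.cons 0 '' T.aboveRoot = T.carrier \ {[]} := by
  ext w
  rcases w with _ | ⟨j, w⟩
  · simp
  · have hj : j :: w ∈ T.carrier → j = 0 := eq_zero_of_cons_mem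
    simp only [Set.mem_image, mem_aboveRoot, List.cons.injEq, Set.mem_sdiff,
      Set.mem_singleton_iff]
    grind

theorem aboveRoot_injective : Function.Injective aboveRoot := fun T T' h =>
  PlaneTree.ext <| by
    rw [← Set.insert_sdiff_self_of_mem T.nil_mem, ← Set.insert_sdiff_self_of_mem T'.nil_mem,
      ← image_cons_aboveRoot, ← image_cons_aboveRoot, h]

theorem ncard_aboveRoot (T : PlaneTree) : T.aboveRoot.ncard = T.size := by
  rw [size, ← image_cons_aboveRoot, Set.ncard_image_of_injective _ List.cons_injective]

theorem finite_aboveRoot_iff (T : PlaneTree) : T.aboveRoot.Finite ↔ T.IsFinite := by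
  rw [← Set.finite_image_iff List.cons_injective.injOn, image_cons_aboveRoot, IsFinite,
    ← Set.finite_insert, Set.insert_sdiff_self_of_mem T.nil_mem]

theorem mem_treesOfSize {T : PlaneTree} {N : ℕ} :
    T ∈ treesOfSize N ↔ T.IsFinite ∧ T.size = N := by
  simp [treesOfSize]

theorem bddAbove_levels {T : PlaneTree} (hT : T.IsFinite) :
    BddAbove {r | (T.level r).Nonempty} := by
  refine ⟨T.size, ?_⟩
  rintro r ⟨u, hu, rfl⟩
  exact length_le_of_mem hT rfl hu

theorem height_le_iff {T : PlaneTree} (hT : T.IsFinite) {m : ℕ} :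
    T.height ≤ m ↔ ∀ w ∈ T.carrier, w.length ≤ m := by
  rw [height, csSup_le_iff (bddAbove_levels hT) ⟨0, [], T.nil_mem, rfl⟩]
  exact ⟨fun h w hw => h _ ⟨w, hw, rfl⟩, fun h r ⟨w, hw, hr⟩ => hr ▸ h w hw⟩

theorem length_le_height {T : PlaneTree} (hT : T.IsFinite) {w : List ℕ} (hw : w ∈ T.carrier) :
    w.length ≤ T.height := (height_le_iff hT).1 le_rfl w hw

theorem exists_length_eq_height {T : PlaneTree} (hT : T.IsFinite) :
    ∃ w ∈ T.carrier, w.length = T.height :=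
  Nat.sSup_mem (s := {r | (T.level r).Nonempty}) ⟨0, [], T.nil_mem, rfl⟩ (bddAbove_levels hT)

theorem one_le_height {T : PlaneTree} (hT : T.IsFinite) : 1 ≤ T.height :=
  length_le_height hT T.zero_mem

theorem height_le_size {T : PlaneTree} (hT : T.IsFinite) : T.height ≤ T.size :=
  (height_le_iff hT).2 fun _ hw => length_le_of_mem hT rfl hw

theorem one_le_size {T : PlaneTree} (hT : T.IsFinite) : 1 ≤ T.size :=
  (one_le_height hT).trans (height_le_size hT)

theorem height_le_iff_aboveRoot {T : PlaneTree} (hT : T.IsFinite) {m : ℕ} :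
    T.height ≤ m ↔ ∀ w ∈ T.aboveRoot, w.length < m := by
  rw [height_le_iff hT]
  refine ⟨fun h w hw => h _ hw, fun h w hw => ?_⟩
  rcases w with _ | ⟨j, w⟩
  · exact Nat.zero_le m
  · obtain rfl := eq_zero_of_cons_mem hw
    exact h w hw

theorem mem_levelFinset {T : PlaneTree} {r : ℕ} {u : List ℕ} :
    u ∈ T.levelFinset r ↔ u ∈ T.carrier ∧ u.length = r := by
  simp [levelFinset, level]

theorem mem_innerVerts {T : PlaneTree} {r : ℕ} {u : List ℕ} :
    u ∈ T.innerVerts r ↔ u ∈ T.carrier ∧ 1 ≤ u.length ∧ u.length < r := by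
  simp only [innerVerts, Finset.mem_biUnion, Finset.mem_Ico, mem_levelFinset]
  grind

/-! ### The decomposition of a tree at the vertex next to the root -/

/-- The tree with a single edge. -/
def edge : PlaneTree := linearTree 0

theorem edge_mem_treesOfSize : edge ∈ treesOfSize 1 := linearTree_mem 0

theorem isFinite_edge : edge.IsFinite := (mem_treesOfSize.1 edge_mem_treesOfSize).1

theorem size_edge : edge.size = 1 := (mem_treesOfSize.1 edge_mem_treesOfSize).2

theorem height_edge : edge.height = 1 :=
  le_antisymm ((height_le_size isFinite_edge).trans_eq size_edge) (one_le_height isFinite_edge)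

theorem aboveRoot_edge : edge.aboveRoot = {[]} :=
  Set.eq_singleton_iff_unique_mem.2 ⟨nil_mem_aboveRoot _, fun w hw => by
    simpa using (height_le_iff_aboveRoot isFinite_edge).1 height_edge.le w hw⟩

theorem eq_edge {T : PlaneTree} (hT : [0, 0] ∉ T.carrier) : T = edge := by
  apply aboveRoot_injective
  rw [aboveRoot_edge, Set.eq_singleton_iff_unique_mem]
  refine ⟨nil_mem_aboveRoot T, fun w hw => ?_⟩
  rcases w with _ | ⟨j, w⟩
  · rfl
  · exact absurd (T.left_sibling_mem [0] j 0 (Nat.zero_le j) (T.prefix_mem [0, j] w hw)) hT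

/-- The tree that is obtained from `R` by attaching `L` as a new leftmost branch to the vertex
next to the root. -/
def join (L R : PlaneTree) : PlaneTree :=
  ofOffspring (fun
    | [] => 1
    | [_] => R.offspring [0] + 1
    | _ :: 0 :: w => L.offspring (0 :: w)
    | _ :: (j + 1) :: w => R.offspring (0 :: j :: w)) rfl

theorem zero_cons_mem_aboveRoot_join {L R : PlaneTree} {w : List ℕ} :
    0 :: w ∈ (join L R).aboveRoot ↔ w ∈ L.aboveRoot := by
  rw [mem_aboveRoot, mem_aboveRoot, join, mem_ofOffspring, mem_iff_inTree L]
  simp [offspring_nil]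

theorem succ_cons_mem_aboveRoot_join {L R : PlaneTree} {j : ℕ} {w : List ℕ} :
    (j + 1) :: w ∈ (join L R).aboveRoot ↔ j :: w ∈ R.aboveRoot := by
  rw [mem_aboveRoot, mem_aboveRoot, join, mem_ofOffspring, mem_iff_inTree R]
  simp [offspring_nil]

/-- The leftmost branch of the vertex next to the root. -/
def leftBranch (T : PlaneTree) : PlaneTree :=
  ofOffspring (fun
    | [] => 1
    | _ :: w => T.offspring (0 :: 0 :: w)) rfl

/-- The tree without the leftmost branch of the vertex next to the root. -/
def rightPart (T : PlaneTree) : PlaneTree :=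
  ofOffspring (fun
    | [] => 1
    | [_] => T.offspring [0] - 1
    | _ :: j :: w => T.offspring (0 :: (j + 1) :: w)) rfl

theorem mem_aboveRoot_leftBranch {T : PlaneTree} (hT : [0, 0] ∈ T.carrier) {w : List ℕ} :
    w ∈ T.leftBranch.aboveRoot ↔ 0 :: w ∈ T.aboveRoot := by
  have h0 : 0 < T.offspring [0] := (append_singleton_mem_iff T [0] 0).1 hT
  rw [mem_aboveRoot, mem_aboveRoot, leftBranch, mem_ofOffspring, mem_iff_inTree T]
  simp [offspring_nil, h0]

theorem cons_mem_aboveRoot_rightPart {T : PlaneTree} {j : ℕ} {w : List ℕ} :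
    j :: w ∈ T.rightPart.aboveRoot ↔ (j + 1) :: w ∈ T.aboveRoot := by
  rw [mem_aboveRoot, mem_aboveRoot, rightPart, mem_ofOffspring, mem_iff_inTree T]
  simp [offspring_nil, Nat.lt_sub_iff_add_lt]

theorem join_leftBranch_rightPart {T : PlaneTree} (hT : [0, 0] ∈ T.carrier) :
    join T.leftBranch T.rightPart = T := by
  refine aboveRoot_injective (Set.ext fun w => ?_)
  rcases w with _ | ⟨_ | j, w⟩
  · exact iff_of_true (nil_mem_aboveRoot _) (nil_mem_aboveRoot _)
  · rw [zero_cons_mem_aboveRoot_join, mem_aboveRoot_leftBranch hT]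
  · rw [succ_cons_mem_aboveRoot_join, cons_mem_aboveRoot_rightPart]

theorem modifyHead_succ_injective : Function.Injective (List.modifyHead Nat.succ) := by
  rintro (_ | ⟨i, u⟩) (_ | ⟨j, w⟩) h <;> simp_all

theorem aboveRoot_join (L R : PlaneTree) : (join L R).aboveRoot =
    List.cons 0 '' L.aboveRoot ∪ List.modifyHead Nat.succ '' R.aboveRoot := by
  ext w
  rcases w with _ | ⟨_ | j, w⟩
  · exact iff_of_true (nil_mem_aboveRoot _) (Or.inr ⟨[], nil_mem_aboveRoot R, rfl⟩)
  · rw [zero_cons_mem_aboveRoot_join, Set.mem_union, List.cons_injective.mem_set_image,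
      or_iff_left]
    rintro ⟨_ | ⟨i, v⟩, -, h⟩ <;> simp at h
  · rw [succ_cons_mem_aboveRoot_join, Set.mem_union, or_iff_right (by simp)]
    exact (modifyHead_succ_injective.mem_set_image (a := j :: w)).symm

theorem disjoint_image_aboveRoot (A B : Set (List ℕ)) :
    Disjoint (List.cons 0 '' A) (List.modifyHead Nat.succ '' B) := by
  rw [Set.disjoint_left]
  rintro _ ⟨v, -, rfl⟩ ⟨_ | ⟨i, w⟩, -, h⟩ <;> simp at h

theorem join_injective {L R L' R' : PlaneTree} (h : join L R = join L' R') :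
    L = L' ∧ R = R' := by
  constructor <;> refine aboveRoot_injective (Set.ext fun w => ?_)
  · rw [← zero_cons_mem_aboveRoot_join (R := R), h, zero_cons_mem_aboveRoot_join]
  · rcases w with _ | ⟨j, w⟩
    · exact iff_of_true (nil_mem_aboveRoot R) (nil_mem_aboveRoot R')
    · rw [← succ_cons_mem_aboveRoot_join (L := L), h, succ_cons_mem_aboveRoot_join]

theorem join_isFinite_iff {L R : PlaneTree} :
    (join L R).IsFinite ↔ L.IsFinite ∧ R.IsFinite := by
  rw [← finite_aboveRoot_iff, aboveRoot_join, Set.finite_union,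
    Set.finite_image_iff List.cons_injective.injOn,
    Set.finite_image_iff modifyHead_succ_injective.injOn, finite_aboveRoot_iff,
    finite_aboveRoot_iff]

theorem size_join {L R : PlaneTree} (hL : L.IsFinite) (hR : R.IsFinite) :
    (join L R).size = L.size + R.size := by
  rw [← ncard_aboveRoot, aboveRoot_join, Set.ncard_union_eq (disjoint_image_aboveRoot _ _)
    (((finite_aboveRoot_iff L).2 hL).image _) (((finite_aboveRoot_iff R).2 hR).image _),
    Set.ncard_image_of_injective _ List.cons_injective,
    Set.ncard_image_of_injective _ modifyHead_succ_injective, ncard_aboveRoot, ncard_aboveRoot]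

theorem height_join_le_iff {L R : PlaneTree} (hL : L.IsFinite) (hR : R.IsFinite) {m : ℕ} :
    (join L R).height ≤ m + 1 ↔ L.height ≤ m ∧ R.height ≤ m + 1 := by
  rw [height_le_iff_aboveRoot (join_isFinite_iff.2 ⟨hL, hR⟩), height_le_iff_aboveRoot hL,
    height_le_iff_aboveRoot hR, aboveRoot_join]
  simp only [Set.mem_union, or_imp, forall_and, Set.forall_mem_image, List.length_cons,
    List.length_modifyHead, Nat.add_lt_add_iff_right]

theorem join_ne_edge (L R : PlaneTree) : join L R ≠ edge := fun h => by
  have : [0] ∈ (join L R).aboveRoot := zero_cons_mem_aboveRoot_join.2 (nil_mem_aboveRoot L)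
  simp [h, aboveRoot_edge] at this

theorem eq_edge_or_eq_join {T : PlaneTree} (hT : T.IsFinite) :
    T = edge ∨ ∃ L R : PlaneTree, L.IsFinite ∧ R.IsFinite ∧ T = join L R := by
  by_cases h : [0, 0] ∈ T.carrier
  · rw [← join_leftBranch_rightPart h, join_isFinite_iff] at hT
    exact Or.inr ⟨_, _, hT.1, hT.2, (join_leftBranch_rightPart h).symm⟩
  · exact Or.inl (eq_edge h)

/-! ### Trees of bounded height -/

/-- The planar trees of size `n` and height at most `m`. -/
def treesOfHeightLE (n m : ℕ) : Finset PlaneTree := {T ∈ treesOfSize n | T.height ≤ m}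

theorem mem_treesOfHeightLE {T : PlaneTree} {n m : ℕ} :
    T ∈ treesOfHeightLE n m ↔ T.IsFinite ∧ T.size = n ∧ T.height ≤ m := by
  simp [treesOfHeightLE, mem_treesOfSize, and_assoc]

theorem treesOfHeightLE_zero (n : ℕ) : treesOfHeightLE n 0 = ∅ := by
  refine Finset.eq_empty_of_forall_notMem fun T hT => ?_
  have ⟨hf, _, hh⟩ := mem_treesOfHeightLE.1 hT
  exact absurd (one_le_height hf) (by omega)

theorem edge_mem_treesOfHeightLE_iff {n m : ℕ} : edge ∈ treesOfHeightLE n (m + 1) ↔ n = 1 := by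
  simp [mem_treesOfHeightLE, isFinite_edge, size_edge, height_edge, eq_comm]

theorem join_mem_treesOfHeightLE_iff {L R : PlaneTree} {n m : ℕ} :
    join L R ∈ treesOfHeightLE n (m + 1) ↔ ∃ a b, a + b = n ∧
      L ∈ treesOfHeightLE a m ∧ R ∈ treesOfHeightLE b (m + 1) := by
  simp only [mem_treesOfHeightLE, join_isFinite_iff]
  constructor
  · rintro ⟨⟨hL, hR⟩, hn, hm⟩
    rw [height_join_le_iff hL hR] at hm
    exact ⟨_, _, (size_join hL hR).symm.trans hn, ⟨hL, rfl, hm.1⟩, hR, rfl, hm.2⟩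
  · rintro ⟨_, _, rfl, ⟨hL, rfl, hLm⟩, hR, rfl, hRm⟩
    exact ⟨⟨hL, hR⟩, size_join hL hR, (height_join_le_iff hL hR).2 ⟨hLm, hRm⟩⟩

open Classical in
theorem card_erase_edge_treesOfHeightLE (n m : ℕ) :
    ((treesOfHeightLE n (m + 1)).erase edge).card =
      ∑ p ∈ Finset.HasAntidiagonal.antidiagonal n,
        (treesOfHeightLE p.1 m).card * (treesOfHeightLE p.2 (m + 1)).card := by
  simp_rw [← Finset.card_product, ← Finset.card_sigma]
  refine (Finset.card_bij (fun x _ => join x.2.1 x.2.2) ?_ ?_ ?_).symm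
  · rintro ⟨⟨a, b⟩, L, R⟩ h
    simp only [Finset.mem_sigma, Finset.HasAntidiagonal.mem_antidiagonal, Finset.mem_product] at h
    exact Finset.mem_erase.2
      ⟨join_ne_edge L R, join_mem_treesOfHeightLE_iff.2 ⟨a, b, h.1, h.2⟩⟩
  · rintro ⟨⟨a, b⟩, L, R⟩ h ⟨⟨a', b'⟩, L', R'⟩ h' he
    simp only [Finset.mem_sigma, Finset.mem_product, mem_treesOfHeightLE] at h h'
    obtain ⟨rfl, rfl⟩ := join_injective he
    obtain rfl : a = a' := h.2.1.2.1.symm.trans h'.2.1.2.1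
    obtain rfl : b = b' := h.2.2.2.1.symm.trans h'.2.2.2.1
    rfl
  · intro T hT
    obtain ⟨hne, hT⟩ := Finset.mem_erase.1 hT
    obtain rfl | ⟨L, R, -, -, rfl⟩ := eq_edge_or_eq_join (mem_treesOfHeightLE.1 hT).1
    · exact absurd rfl hne
    · obtain ⟨a, b, hab, hLR⟩ := join_mem_treesOfHeightLE_iff.1 hT
      refine ⟨⟨(a, b), L, R⟩, ?_, rfl⟩
      simpa only [Finset.mem_sigma, Finset.HasAntidiagonal.mem_antidiagonal, Finset.mem_product]
        using ⟨hab, hLR⟩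

theorem card_treesOfHeightLE_succ (n m : ℕ) : (treesOfHeightLE n (m + 1)).card =
    (if n = 1 then 1 else 0) + ∑ p ∈ Finset.HasAntidiagonal.antidiagonal n,
      (treesOfHeightLE p.1 m).card * (treesOfHeightLE p.2 (m + 1)).card := by
  classical
  rw [← card_erase_edge_treesOfHeightLE]
  split_ifs with h
  · rw [add_comm 1, Finset.card_erase_add_one (edge_mem_treesOfHeightLE_iff.2 h)]
  · rw [zero_add, Finset.erase_eq_of_notMem (mt edge_mem_treesOfHeightLE_iff.1 h)]

/-- The generating series of the trees of height at most `m`. -/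
def heightSeries (m : ℕ) : PowerSeries ℝ :=
  PowerSeries.mk fun n => ((treesOfHeightLE n m).card : ℝ)

theorem heightSeries_succ (m : ℕ) :
    heightSeries (m + 1) = PowerSeries.X + heightSeries m * heightSeries (m + 1) := by
  ext n
  simp only [heightSeries, PowerSeries.coeff_mk, map_add, PowerSeries.coeff_X,
    PowerSeries.coeff_mul]
  exact_mod_cast card_treesOfHeightLE_succ n m

/-- The number of trees of size `n` and height `m`. -/
def heightCount (n m : ℕ) : ℕ := {T ∈ treesOfSize n | T.height = m}.card

theorem card_treesOfHeightLE_add_heightCount (n m : ℕ) :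
    (treesOfHeightLE n m).card + heightCount n (m + 1) = (treesOfHeightLE n (m + 1)).card := by
  classical
  rw [treesOfHeightLE, treesOfHeightLE, heightCount, ← Finset.card_union_of_disjoint]
  · simp only [← Finset.filter_or, Nat.le_succ_iff]
  · exact Finset.disjoint_filter.2 fun T _ hle heq => by omega

theorem heightCount_zero (n : ℕ) : heightCount n 0 = 0 := by
  simpa [heightCount, treesOfHeightLE] using congrArg Finset.card (treesOfHeightLE_zero n)

theorem heightCount_one {n : ℕ} (hn : n ≠ 1) : heightCount n 1 = 0 := by
  have hcard : (treesOfHeightLE n 1).card = 0 :=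
    (card_treesOfHeightLE_succ n 0).trans (by simp [treesOfHeightLE_zero, hn])
  have hadd : (treesOfHeightLE n 0).card + heightCount n 1 = (treesOfHeightLE n 1).card :=
    card_treesOfHeightLE_add_heightCount n 0
  omega

/-- The generating series of the trees of height `m + 1`. -/
def heightDiff (m : ℕ) : PowerSeries ℝ := heightSeries (m + 1) - heightSeries m

theorem coeff_heightDiff (n m : ℕ) :
    PowerSeries.coeff n (heightDiff m) = (heightCount n (m + 1) : ℝ) := by
  simp [heightDiff, heightSeries, ← card_treesOfHeightLE_add_heightCount]

theorem heightDiff_recurrence (m : ℕ) :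
    PowerSeries.X * (heightDiff m + 2 * heightDiff (m + 1) + heightDiff (m + 2)) =
      heightDiff (m + 1) * (1 + (heightDiff m + heightDiff (m + 1) + heightDiff (m + 2))) := by
  have hA := heightSeries_succ m
  have hB := heightSeries_succ (m + 1)
  have hC := heightSeries_succ (m + 2)
  simp only [heightDiff, add_assoc, Nat.reduceAdd] at hA hB hC ⊢
  set A := heightSeries m
  set B := heightSeries (m + 1)
  set C := heightSeries (m + 2)
  set D := heightSeries (m + 3)
  have hXA : PowerSeries.X = B * (1 - A) := by linear_combination -hA
  have hXB : PowerSeries.X = C * (1 - B) := by linear_combination -hB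
  have hXC : PowerSeries.X = D * (1 - C) := by linear_combination -hC
  have lower : PowerSeries.X * (B - A) = (C - B) * ((1 - B) * (1 - A)) := by
    linear_combination (1 - A) * hXB - (1 - B) * hXA
  have upper : PowerSeries.X * (D - C) = (C - B) * (D * C) := by
    linear_combination D * hXB - C * hXC
  linear_combination lower + upper + (C - B) * (-hA - hC)

theorem heightCount_succ_le (n m : ℕ) : heightCount (n + 1) (m + 2) ≤
    heightCount n (m + 1) + 2 * heightCount n (m + 2) + heightCount n (m + 3) := by
  have h := congrArg (PowerSeries.coeff (n + 1)) (heightDiff_recurrence m)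
  rw [mul_add (heightDiff _), mul_one, map_add, mul_comm PowerSeries.X,
    PowerSeries.coeff_succ_mul_X, PowerSeries.coeff_mul, two_mul] at h
  simp only [map_add, coeff_heightDiff, add_assoc, Nat.reduceAdd] at h
  have hprod : (0 : ℝ) ≤ ∑ p ∈ Finset.HasAntidiagonal.antidiagonal (n + 1),
      (heightCount p.1 (m + 2) : ℝ) *
        (heightCount p.2 (m + 1) + (heightCount p.2 (m + 2) + heightCount p.2 (m + 3))) :=
    Finset.sum_nonneg fun _ _ => by positivity
  have : (heightCount (n + 1) (m + 2) : ℝ) ≤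
      heightCount n (m + 1) + 2 * heightCount n (m + 2) + heightCount n (m + 3) := by linarith
  exact_mod_cast this

/-! ### The partition functions -/

/-- The sum of `k ^ h(T)` over the trees `T` of size `n`: the partition function `Z_n` for
`k = exp (- μ)`. -/
def heightSum (k : ℝ) (n : ℕ) : ℝ := ∑ T ∈ treesOfSize n, k ^ T.height

theorem partitionFunction_eq_heightSum (μ : ℝ) (n : ℕ) :
    partitionFunction μ n = heightSum (Real.exp (-μ)) n := by
  refine Finset.sum_congr rfl fun T _ => ?_
  rw [← Real.exp_nat_mul, mul_comm]

theorem heightSum_pos {k : ℝ} (hk : 0 < k) {n : ℕ} (hn : 1 ≤ n) : 0 < heightSum k n := by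
  obtain ⟨n, rfl⟩ := Nat.exists_eq_add_of_le' hn
  exact Finset.sum_pos (fun T _ => by positivity) ⟨_, linearTree_mem n⟩

theorem heightSum_eq_sum_range (k : ℝ) {n H : ℕ} (hH : n < H) :
    heightSum k n = ∑ h ∈ Finset.range H, k ^ h * heightCount n h := by
  have height_lt : ∀ T ∈ treesOfSize n, T.height ∈ Finset.range H := fun T hT => by
    have ⟨hf, hs⟩ := mem_treesOfSize.1 hT
    exact Finset.mem_range.2 ((height_le_size hf).trans_lt (hs ▸ hH))
  rw [heightSum, ← Finset.sum_fiberwise_of_maps_to height_lt]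
  refine Finset.sum_congr rfl fun h _ => ?_
  rw [heightCount, Finset.sum_congr rfl (g := fun _ => k ^ h)
    (fun T hT => by rw [(Finset.mem_filter.1 hT).2]), Finset.sum_const, nsmul_eq_mul, mul_comm]

theorem sum_range_shift_le_heightSum {k : ℝ} (hk : 0 ≤ k) (n j H : ℕ) :
    ∑ h ∈ Finset.range H, k ^ (h + j) * heightCount n (h + j) ≤ heightSum k n := by
  rw [heightSum_eq_sum_range k (show n < j + (n + 1 + H) by omega),
    Finset.sum_range_add (n := j)]
  simp only [add_comm _ j]
  have hhead : 0 ≤ ∑ h ∈ Finset.range j, k ^ h * (heightCount n h : ℝ) := by positivity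
  have htail : ∑ h ∈ Finset.range H, k ^ (j + h) * (heightCount n (j + h) : ℝ) ≤
      ∑ h ∈ Finset.range (n + 1 + H), k ^ (j + h) * (heightCount n (j + h) : ℝ) :=
    Finset.sum_le_sum_of_subset_of_nonneg (Finset.range_mono (by omega))
      fun _ _ _ => by positivity
  linarith

theorem heightSum_succ_le {k : ℝ} (hk : 0 < k) {n : ℕ} (hn : 1 ≤ n) :
    k * heightSum k (n + 1) ≤ (1 + k) ^ 2 * heightSum k n := by
  have shifted (j : ℕ) := sum_range_shift_le_heightSum hk.le n j (n + 1)
  calc k * heightSum k (n + 1)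
      = ∑ h ∈ Finset.range (n + 1), k * (k ^ (h + 2) * heightCount (n + 1) (h + 2)) := by
        rw [heightSum_eq_sum_range k (show n + 1 < (n + 1) + 2 by omega),
          Finset.sum_range_succ', Finset.sum_range_succ', heightCount_zero,
          heightCount_one (by omega), ← Finset.mul_sum]
        simp
    _ ≤ ∑ h ∈ Finset.range (n + 1), k * (k ^ (h + 2) *
          (heightCount n (h + 1) + 2 * heightCount n (h + 2) + heightCount n (h + 3))) := by
        gcongr with h
        exact_mod_cast heightCount_succ_le n h
    _ = k ^ 2 * ∑ h ∈ Finset.range (n + 1), k ^ (h + 1) * (heightCount n (h + 1) : ℝ) +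
          2 * k * ∑ h ∈ Finset.range (n + 1), k ^ (h + 2) * (heightCount n (h + 2) : ℝ) +
          ∑ h ∈ Finset.range (n + 1), k ^ (h + 3) * (heightCount n (h + 3) : ℝ) := by
        simp only [Finset.mul_sum, ← Finset.sum_add_distrib]
        exact Finset.sum_congr rfl fun h _ => by ring
    _ ≤ k ^ 2 * heightSum k n + 2 * k * heightSum k n + heightSum k n := by
        gcongr
        exacts [shifted 1, shifted 2, shifted 3]
    _ = (1 + k) ^ 2 * heightSum k n := by ring

theorem criticalPoint_pos {k : ℝ} (hk : 0 < k) : 0 < criticalPoint k := by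
  rw [criticalPoint]
  positivity

theorem criticalPoint_mul_heightSum_succ_le {k : ℝ} (hk : 0 < k) {n : ℕ} (hn : 1 ≤ n) :
    criticalPoint k * heightSum k (n + 1) ≤ heightSum k n := by
  rw [criticalPoint, div_mul_eq_mul_div, div_le_iff₀ (by positivity), mul_comm (heightSum k n)]
  exact heightSum_succ_le hk hn

theorem criticalPoint_pow_mul_heightSum_le {k : ℝ} (hk : 0 < k) {n : ℕ} (hn : 1 ≤ n) (j : ℕ) :
    criticalPoint k ^ j * heightSum k (n + j) ≤ heightSum k n := by
  induction j with
  | zero => simp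
  | succ j ih =>
    calc criticalPoint k ^ (j + 1) * heightSum k (n + (j + 1))
        = criticalPoint k ^ j * (criticalPoint k * heightSum k (n + j + 1)) := by
          rw [pow_succ, mul_assoc, add_assoc]
      _ ≤ criticalPoint k ^ j * heightSum k (n + j) := by
          have := criticalPoint_pos hk
          gcongr
          exact criticalPoint_mul_heightSum_succ_le hk (by omega)
      _ ≤ heightSum k n := ih

/-! ### The generating function of all finite trees -/

/-- The finite trees of size at most `M`. -/
def smallTrees (M : ℕ) : Finset PlaneTree :=
  ((Finset.range (M + 1)).finite_toSet.biUnion fun n _ => finite_setOf_size n).toFinset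

theorem mem_smallTrees {T : PlaneTree} {M : ℕ} :
    T ∈ smallTrees M ↔ T.IsFinite ∧ T.size ≤ M := by
  simp [smallTrees]

theorem smallTrees_zero : smallTrees 0 = ∅ :=
  Finset.eq_empty_of_forall_notMem fun T hT => by
    have ⟨hf, hs⟩ := mem_smallTrees.1 hT
    exact absurd (one_le_size hf) (by omega)

open Classical in
theorem smallTrees_succ_subset (M : ℕ) : smallTrees (M + 1) ⊆
    insert edge ((smallTrees M ×ˢ smallTrees M).image fun p => join p.1 p.2) := by
  intro T hT
  have ⟨hf, hs⟩ := mem_smallTrees.1 hT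
  obtain rfl | ⟨L, R, hL, hR, rfl⟩ := eq_edge_or_eq_join hf
  · exact Finset.mem_insert_self _ _
  · rw [size_join hL hR] at hs
    have hL1 := one_le_size hL
    have hR1 := one_le_size hR
    refine Finset.mem_insert_of_mem (Finset.mem_image.2 ⟨(L, R), Finset.mem_product.2 ?_, rfl⟩)
    exact ⟨mem_smallTrees.2 ⟨hL, (by omega : L.size ≤ M)⟩,
      mem_smallTrees.2 ⟨hR, (by omega : R.size ≤ M)⟩⟩

theorem sum_smallTrees_succ_le {g : ℝ} (hg : 0 ≤ g) (M : ℕ) :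
    ∑ T ∈ smallTrees (M + 1), g ^ T.size ≤ g + (∑ T ∈ smallTrees M, g ^ T.size) ^ 2 := by
  classical
  have hinj : Function.Injective fun p : PlaneTree × PlaneTree => join p.1 p.2 :=
    fun p q h => Prod.ext_iff.2 (join_injective h)
  calc ∑ T ∈ smallTrees (M + 1), g ^ T.size
      ≤ ∑ T ∈ insert edge ((smallTrees M ×ˢ smallTrees M).image fun p => join p.1 p.2),
          g ^ T.size :=
        Finset.sum_le_sum_of_subset_of_nonneg (smallTrees_succ_subset M)
          fun _ _ _ => pow_nonneg hg _
    _ = g + ∑ p ∈ smallTrees M ×ˢ smallTrees M, g ^ (join p.1 p.2).size := by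
        rw [Finset.sum_insert (by simp [join_ne_edge]), size_edge, pow_one,
          Finset.sum_image hinj.injOn]
    _ = g + ∑ p ∈ smallTrees M ×ˢ smallTrees M, g ^ p.1.size * g ^ p.2.size := by
        congr 1
        refine Finset.sum_congr rfl fun p hp => ?_
        have ⟨hL, hR⟩ := Finset.mem_product.1 hp
        rw [size_join (mem_smallTrees.1 hL).1 (mem_smallTrees.1 hR).1, pow_add]
    _ = g + (∑ T ∈ smallTrees M, g ^ T.size) ^ 2 := by
        rw [sq, Finset.sum_mul_sum, Finset.sum_product]

theorem sum_smallTrees_le {x : ℝ} (hx0 : 0 ≤ x) (hx1 : x ≤ 1) (M : ℕ) :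
    ∑ T ∈ smallTrees M, (x * (1 - x)) ^ T.size ≤ x := by
  have hg : 0 ≤ x * (1 - x) := mul_nonneg hx0 (sub_nonneg.2 hx1)
  induction M with
  | zero => simpa [smallTrees_zero] using hx0
  | succ M ih =>
    calc _ ≤ x * (1 - x) + (∑ T ∈ smallTrees M, (x * (1 - x)) ^ T.size) ^ 2 :=
          sum_smallTrees_succ_le hg M
      _ ≤ x * (1 - x) + x ^ 2 := by gcongr
      _ = x := by ring

theorem exists_map_subtype_subset_smallTrees (F : Finset {T : PlaneTree // T.IsFinite}) :
    ∃ M, F.map (Function.Embedding.subtype _) ⊆ smallTrees M := by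
  refine ⟨F.sup fun T => T.1.size, fun T hT => ?_⟩
  obtain ⟨S, hS, rfl⟩ := Finset.mem_map.1 hT
  exact mem_smallTrees.2
    ⟨S.2, Finset.le_sup (f := fun T : {T : PlaneTree // T.IsFinite} => T.1.size) hS⟩

theorem sum_pow_size_le {x : ℝ} (hx0 : 0 ≤ x) (hx1 : x ≤ 1)
    (F : Finset {T : PlaneTree // T.IsFinite}) : ∑ T ∈ F, (x * (1 - x)) ^ T.1.size ≤ x := by
  have hg : 0 ≤ x * (1 - x) := mul_nonneg hx0 (sub_nonneg.2 hx1)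
  obtain ⟨M, hM⟩ := exists_map_subtype_subset_smallTrees F
  calc ∑ T ∈ F, (x * (1 - x)) ^ T.1.size
      = ∑ T ∈ F.map (Function.Embedding.subtype _), (x * (1 - x)) ^ T.size := by
        rw [Finset.sum_map]
        rfl
    _ ≤ ∑ T ∈ smallTrees M, (x * (1 - x)) ^ T.size :=
        Finset.sum_le_sum_of_subset_of_nonneg hM fun _ _ _ => pow_nonneg hg _
    _ ≤ x := sum_smallTrees_le hx0 hx1 M

theorem summable_pow_size {x : ℝ} (hx0 : 0 ≤ x) (hx1 : x ≤ 1) :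
    Summable fun T : {T : PlaneTree // T.IsFinite} => (x * (1 - x)) ^ T.1.size :=
  summable_of_sum_le (fun _ => pow_nonneg (mul_nonneg hx0 (sub_nonneg.2 hx1)) _)
    (sum_pow_size_le hx0 hx1)

/-- A finite tree is a single edge or the join of a unique pair of finite trees. -/
def finiteTreeEquiv : Unit ⊕ {T : PlaneTree // T.IsFinite} × {T : PlaneTree // T.IsFinite} ≃
    {T : PlaneTree // T.IsFinite} :=
  Equiv.ofBijective (Sum.elim (fun _ => ⟨edge, isFinite_edge⟩)
    fun p => ⟨join p.1.1 p.2.1, join_isFinite_iff.2 ⟨p.1.2, p.2.2⟩⟩) <| by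
  constructor
  · refine Function.Injective.sumElim (Function.injective_of_subsingleton _) ?_ ?_
    · rintro ⟨⟨L, hL⟩, R, hR⟩ ⟨⟨L', hL'⟩, R', hR'⟩ h
      obtain ⟨rfl, rfl⟩ := join_injective (congrArg Subtype.val h)
      rfl
    · exact fun _ p h => join_ne_edge _ _ (congrArg Subtype.val h).symm
  · rintro ⟨T, hT⟩
    obtain rfl | ⟨L, R, hL, hR, rfl⟩ := eq_edge_or_eq_join hT
    · exact ⟨Sum.inl (), rfl⟩
    · exact ⟨Sum.inr (⟨L, hL⟩, ⟨R, hR⟩), rfl⟩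

theorem treeSeries_eq_add_sq {g : ℝ}
    (hs : Summable fun T : {T : PlaneTree // T.IsFinite} => g ^ T.1.size) :
    treeSeries g = g + treeSeries g ^ 2 := by
  have hedge : (finiteTreeEquiv (Sum.inl ())).1.size = 1 := size_edge
  have hjoin (p) : (finiteTreeEquiv (Sum.inr p)).1.size = p.1.1.size + p.2.1.size :=
    size_join p.1.2 p.2.2
  have hs' := finiteTreeEquiv.summable_iff.2 hs
  calc treeSeries g
      = ∑' x, g ^ (finiteTreeEquiv x).1.size := (finiteTreeEquiv.tsum_eq _).symm
    _ = ∑' x, g ^ (finiteTreeEquiv (Sum.inl x)).1.size +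
          ∑' p, g ^ (finiteTreeEquiv (Sum.inr p)).1.size :=
        Summable.tsum_sum (hs'.comp_injective Sum.inl_injective)
          (hs'.comp_injective Sum.inr_injective)
    _ = g + ∑' p : {T : PlaneTree // T.IsFinite} × {T : PlaneTree // T.IsFinite},
          g ^ p.1.1.size * g ^ p.2.1.size := by
        simp only [hjoin, pow_add, tsum_fintype, Finset.univ_unique, PUnit.default_eq_unit,
          Finset.sum_singleton, hedge, pow_one]
    _ = g + treeSeries g ^ 2 := by
        rw [sq, treeSeries, tsum_mul_tsum_of_summable_norm hs.norm hs.norm]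

theorem treeSeries_mul_one_sub {x : ℝ} (hx0 : 0 ≤ x) (hx1 : x < 1 / 2) :
    treeSeries (x * (1 - x)) = x := by
  have hs := summable_pow_size hx0 (by linarith)
  have hle : treeSeries (x * (1 - x)) ≤ x :=
    hs.tsum_le_of_sum_le (sum_pow_size_le hx0 (by linarith))
  have hroots : (treeSeries (x * (1 - x)) - x) * (treeSeries (x * (1 - x)) - (1 - x)) = 0 := by
    linear_combination -treeSeries_eq_add_sq hs
  rcases mul_eq_zero.1 hroots with h | h <;> linarith

theorem criticalPoint_eq {k : ℝ} (hk : 0 < k) :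
    criticalPoint k = 1 / (1 + k) * (1 - 1 / (1 + k)) := by
  rw [criticalPoint]
  field_simp
  ring

theorem summable_criticalPoint_pow_size {k : ℝ} (hk : 0 < k) :
    Summable fun T : {T : PlaneTree // T.IsFinite} => criticalPoint k ^ T.1.size := by
  rw [criticalPoint_eq hk]
  refine summable_pow_size (by positivity) ?_
  rw [div_le_one (by positivity)]
  linarith

theorem treeSeries_criticalPoint {k : ℝ} (hk : 1 < k) :
    treeSeries (criticalPoint k) = 1 / (1 + k) := by
  rw [criticalPoint_eq (by linarith)]
  refine treeSeries_mul_one_sub (by positivity) ?_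
  rw [div_lt_div_iff₀ (by linarith) (by norm_num)]
  linarith

/-! ### Grafting branches onto a tree -/

/-- The tree that agrees with `T₀` up to height `r` and whose branch above the edge that leads to
a vertex `u` at height `r` is `f u`. -/
def graft (T₀ : PlaneTree) (r : ℕ) (hr : 1 ≤ r) (f : List ℕ → PlaneTree) : PlaneTree :=
  ofOffspring (fun v => if v.length < r then T₀.offspring v else
    (f (v.take r)).offspring (0 :: v.drop r)) (by
      rw [List.length_nil, if_pos (by omega), offspring_nil])

section Graft

variable {T₀ : PlaneTree} {r : ℕ} {hr : 1 ≤ r} {f : List ℕ → PlaneTree}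

theorem ballVerts_graft : (graft T₀ r hr f).ballVerts r = T₀.ballVerts r := by
  refine ((ballVerts_eq_iff _ _ _).2 fun v hv hvr => ?_).symm
  rw [graft, mem_ofOffspring] at hv
  rw [graft, offspring_ofOffspring hv, if_pos hvr]

theorem mem_graft_of_length_le {w : List ℕ} (hw : w.length ≤ r) :
    w ∈ (graft T₀ r hr f).carrier ↔ w ∈ T₀.carrier := by
  have := Set.ext_iff.1 (ballVerts_graft (T₀ := T₀) (hr := hr) (f := f)) w
  simpa [ballVerts, hw] using this

theorem append_mem_graft_iff {u w : List ℕ} (hu : u.length = r) :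
    u ++ w ∈ (graft T₀ r hr f).carrier ↔ u ∈ T₀.carrier ∧ w ∈ (f u).aboveRoot := by
  rw [← mem_graft_of_length_le (f := f) (hr := hr) hu.le, mem_aboveRoot]
  rw [graft, mem_ofOffspring, mem_ofOffspring, inTree_append, mem_iff_inTree (f u)]
  refine and_congr_right fun _ => ?_
  simp [hu, offspring_nil]

theorem graft_carrier_sdiff_nil : (graft T₀ r hr f).carrier \ {[]} = ↑(T₀.innerVerts r) ∪
    ⋃ u ∈ (T₀.levelFinset r : Set (List ℕ)), (u ++ ·) '' (f u).aboveRoot := by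
  ext v
  simp only [Set.mem_sdiff, Set.mem_singleton_iff, Set.mem_union, Finset.mem_coe, mem_innerVerts,
    Set.mem_iUnion, mem_levelFinset, Set.mem_image, exists_prop]
  constructor
  · rintro ⟨hv, hne⟩
    by_cases hvr : v.length < r
    · exact Or.inl ⟨(mem_graft_of_length_le hvr.le).1 hv, List.length_pos_of_ne_nil hne, hvr⟩
    · have hl : (v.take r).length = r := List.length_take_of_le (by omega)
      rw [← List.take_append_drop r v, append_mem_graft_iff hl] at hv
      exact Or.inr ⟨_, ⟨hv.1, hl⟩, _, hv.2, List.take_append_drop r v⟩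
  · rintro (⟨hv, h1, h2⟩ | ⟨u, ⟨hu, hl⟩, w, hw, rfl⟩)
    · exact ⟨(mem_graft_of_length_le h2.le).2 hv, List.ne_nil_of_length_pos h1⟩
    · refine ⟨(append_mem_graft_iff hl).2 ⟨hu, hw⟩, List.ne_nil_of_length_pos ?_⟩
      rw [List.length_append]
      omega

theorem isFinite_graft (hf : ∀ u ∈ T₀.levelFinset r, (f u).IsFinite) :
    (graft T₀ r hr f).IsFinite := by
  rw [IsFinite, ← Set.insert_sdiff_self_of_mem (graft T₀ r hr f).nil_mem, graft_carrier_sdiff_nil]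
  exact ((Finset.finite_toSet _).union ((Finset.finite_toSet _).biUnion fun u hu =>
    ((finite_aboveRoot_iff _).2 (hf u hu)).image _)).insert _

theorem pairwiseDisjoint_image_append (r : ℕ) (A : List ℕ → Set (List ℕ)) :
    {u : List ℕ | u.length = r}.PairwiseDisjoint fun u => (u ++ ·) '' A u := by
  intro u hu v hv huv
  rw [Function.onFun, Set.disjoint_left]
  rintro _ ⟨w, -, rfl⟩ ⟨w', -, h⟩
  exact huv (List.append_inj_left h ((show v.length = r from hv).trans hu.symm)).symm

theorem size_graft (hf : ∀ u ∈ T₀.levelFinset r, (f u).IsFinite) :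
    (graft T₀ r hr f).size = (T₀.innerVerts r).card + ∑ u ∈ T₀.levelFinset r, (f u).size := by
  have branch_finite (u) (hu : u ∈ T₀.levelFinset r) :
      ((u ++ ·) '' (f u).aboveRoot).Finite := ((finite_aboveRoot_iff _).2 (hf u hu)).image _
  have level_subset : (T₀.levelFinset r : Set (List ℕ)) ⊆ {u | u.length = r} :=
    fun u hu => (mem_levelFinset.1 hu).2
  have inner_disjoint : Disjoint (T₀.innerVerts r : Set (List ℕ))
      (⋃ u ∈ (T₀.levelFinset r : Set (List ℕ)), (u ++ ·) '' (f u).aboveRoot) := by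
    refine Set.disjoint_iUnion₂_right.2 fun u hu => Set.disjoint_right.2 ?_
    rintro _ ⟨w, -, rfl⟩ hw
    have hlt := (mem_innerVerts.1 hw).2.2
    have := (mem_levelFinset.1 hu).2
    rw [List.length_append] at hlt
    omega
  rw [size, graft_carrier_sdiff_nil, Set.ncard_union_eq inner_disjoint (Finset.finite_toSet _)
    ((Finset.finite_toSet _).biUnion branch_finite), Set.ncard_coe_finset,
    (Finset.finite_toSet _).ncard_biUnion branch_finite
      ((pairwiseDisjoint_image_append r _).subset level_subset), finsum_mem_coe_finset]
  refine congrArg _ (Finset.sum_congr rfl fun u _ => ?_)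
  rw [Set.ncard_image_of_injective _ (List.append_right_injective u), ncard_aboveRoot]

theorem le_height_graft (hf : ∀ u ∈ T₀.levelFinset r, (f u).IsFinite) {u : List ℕ}
    (hu : u ∈ T₀.levelFinset r) : r - 1 + (f u).height ≤ (graft T₀ r hr f).height := by
  have ⟨hu₀, hur⟩ := mem_levelFinset.1 hu
  suffices (f u).height ≤ (graft T₀ r hr f).height - r + 1 by
    have := length_le_height (isFinite_graft hf)
      ((mem_graft_of_length_le (f := f) (hr := hr) hur.le).2 hu₀)
    omega
  refine (height_le_iff_aboveRoot (hf u hu)).2 fun w hw => ?_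
  have := length_le_height (isFinite_graft hf) ((append_mem_graft_iff (hr := hr) hur).2 ⟨hu₀, hw⟩)
  rw [List.length_append] at this
  omega

theorem eq_of_graft_eq_graft {f' : List ℕ → PlaneTree}
    (h : graft T₀ r hr f = graft T₀ r hr f') {u : List ℕ} (hu : u ∈ T₀.levelFinset r) :
    f u = f' u := by
  have ⟨hu₀, hur⟩ := mem_levelFinset.1 hu
  refine aboveRoot_injective (Set.ext fun w => ?_)
  rw [← and_iff_right (b := w ∈ (f u).aboveRoot) hu₀, ← append_mem_graft_iff (hr := hr) hur, h,
    append_mem_graft_iff hur, and_iff_right hu₀]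

end Graft

theorem mem_closedBall_iff {T T' : PlaneTree} {r : ℕ} (hr : 1 ≤ r) :
    T ∈ Metric.closedBall T' (1 / (r : ℝ)) ↔ T.ballVerts r = T'.ballVerts r := by
  rw [Metric.mem_closedBall]
  refine ⟨fun h => ?_, fun h => csInf_le (commonRadii_bddBelow T T') ⟨r, hr, h, rfl⟩⟩
  obtain rfl | ⟨n, hn, rfl⟩ : r = 1 ∨ ∃ n, 1 ≤ n ∧ r = n + 1 := by
    rcases hr.eq_or_lt with h | h
    exacts [Or.inl h.symm, Or.inr ⟨r - 1, by omega, by omega⟩]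
  · rw [ballVerts_one, ballVerts_one]
  have hn0 : (0 : ℝ) < n := by exact_mod_cast hn
  have hlt : 1 / ((n + 1 : ℕ) : ℝ) < 1 / n :=
    one_div_lt_one_div_of_lt hn0 (by exact_mod_cast n.lt_succ_self)
  obtain ⟨_, ⟨s, hs, hsT, rfl⟩, hs'⟩ :=
    exists_lt_of_csInf_lt (commonRadii_nonempty T T') (h.trans_lt hlt)
  have : (n : ℝ) < s := (one_div_lt_one_div (by exact_mod_cast hs) hn0).1 hs'
  exact ballVerts_mono_eq hsT (by exact_mod_cast this)

/-! ### Trees with one large branch -/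

section OneLargeBranch

variable {T₀ : PlaneTree} {r : ℕ} {hr : 1 ≤ r} {M N : ℕ} {i : List ℕ}

/-- The tree that agrees with `T₀` up to height `r`, with branch `T` above the vertex `i` at
height `r` and branch `F u` above every other vertex `u` at height `r`. -/
def graftAt (T₀ : PlaneTree) (r : ℕ) (hr : 1 ≤ r) (i : List ℕ)
    (F : (T₀.levelFinset r).erase i → PlaneTree) (T : PlaneTree) : PlaneTree :=
  graft T₀ r hr (Function.extend Subtype.val F fun _ => T)

theorem extend_branches_self (F : (T₀.levelFinset r).erase i → PlaneTree) (T : PlaneTree) :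
    Function.extend Subtype.val F (fun _ => T) i = T :=
  Function.extend_apply' F _ i fun ⟨u, hu⟩ => Finset.ne_of_mem_erase u.2 hu

theorem extend_branches_of_ne (F : (T₀.levelFinset r).erase i → PlaneTree) (T : PlaneTree)
    (u : (T₀.levelFinset r).erase i) : Function.extend Subtype.val F (fun _ => T) u = F u :=
  Subtype.val_injective.extend_apply F _ u

theorem isFinite_extend_branches {F : (T₀.levelFinset r).erase i → PlaneTree} {T : PlaneTree}
    (hF : ∀ u, (F u).IsFinite) (hT : T.IsFinite) (u : List ℕ) :
    (Function.extend Subtype.val F (fun _ => T) u).IsFinite := by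
  by_cases hu : ∃ v : (T₀.levelFinset r).erase i, v = u
  · obtain ⟨v, rfl⟩ := hu
    exact (extend_branches_of_ne F T v).symm ▸ hF v
  · rwa [Function.extend_apply' _ _ _ hu]

theorem size_graftAt (hi : i ∈ T₀.levelFinset r) {F : (T₀.levelFinset r).erase i → PlaneTree}
    {T : PlaneTree} (hF : ∀ u, (F u).IsFinite) (hT : T.IsFinite) :
    (graftAt T₀ r hr i F T).size =
      (T₀.innerVerts r).card + (∑ u, (F u).size + T.size) := by
  rw [graftAt, size_graft fun u _ => isFinite_extend_branches hF hT u,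
    ← Finset.sum_erase_add _ _ hi, extend_branches_self, ← Finset.sum_coe_sort]
  simp only [extend_branches_of_ne]

open Classical in
/-- The trees of size `N` that agree with `T₀` up to height `r` and whose branches above the
vertices at height `r` other than `i` have size at most `M`. -/
def oneLargeBranch (T₀ : PlaneTree) (r : ℕ) (hr : 1 ≤ r) (M N : ℕ) (i : List ℕ) :
    Finset PlaneTree :=
  ((Fintype.piFinset fun _ : (T₀.levelFinset r).erase i => smallTrees M).sigma
    fun F => treesOfSize (N - ((T₀.innerVerts r).card + ∑ u, (F u).size))).image
      fun x => graftAt T₀ r hr i x.1 x.2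

theorem mem_oneLargeBranch {S : PlaneTree} : S ∈ oneLargeBranch T₀ r hr M N i ↔
    ∃ (F : (T₀.levelFinset r).erase i → PlaneTree) (T : PlaneTree),
      (∀ u, F u ∈ smallTrees M) ∧
      T ∈ treesOfSize (N - ((T₀.innerVerts r).card + ∑ u, (F u).size)) ∧
      graftAt T₀ r hr i F T = S := by
  simp [oneLargeBranch, and_assoc]

theorem sum_size_branches_le (hi : i ∈ T₀.levelFinset r)
    {F : (T₀.levelFinset r).erase i → PlaneTree} (hF : ∀ u, F u ∈ smallTrees M) :
    ∑ u, (F u).size ≤ ((T₀.levelFinset r).card - 1) * M := by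
  rw [← Finset.card_erase_of_mem hi, ← Fintype.card_coe, ← smul_eq_mul]
  exact Finset.sum_le_card_nsmul _ _ _ fun u _ => (mem_smallTrees.1 (hF u)).2

theorem oneLargeBranch_subset (hi : i ∈ T₀.levelFinset r)
    (hN : (T₀.innerVerts r).card + (T₀.levelFinset r).card * M < N) :
    ∀ S ∈ oneLargeBranch T₀ r hr M N i,
      S ∈ treesOfSize N ∧ S ∈ Metric.closedBall T₀ (1 / (r : ℝ)) := by
  intro S hS
  obtain ⟨F, T, hF, hT, rfl⟩ := mem_oneLargeBranch.1 hS
  have hF_finite (u) : (F u).IsFinite := (mem_smallTrees.1 (hF u)).1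
  have ⟨hT_finite, hT_size⟩ := mem_treesOfSize.1 hT
  refine ⟨mem_treesOfSize.2 ⟨isFinite_graft fun u _ => isFinite_extend_branches hF_finite
    hT_finite u, ?_⟩, (mem_closedBall_iff hr).2 ballVerts_graft⟩
  have := (sum_size_branches_le hi hF).trans (Nat.mul_le_mul_right M (Nat.sub_le _ 1))
  rw [size_graftAt hi hF_finite hT_finite]
  omega

theorem disjoint_oneLargeBranch {j : List ℕ} (hi : i ∈ T₀.levelFinset r)
    (hij : i ≠ j)
    (hN : (T₀.innerVerts r).card + (T₀.levelFinset r).card * M < N) :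
    Disjoint (oneLargeBranch T₀ r hr M N i) (oneLargeBranch T₀ r hr M N j) := by
  rw [Finset.disjoint_left]
  intro S hS hS'
  obtain ⟨F, T, hF, hT, rfl⟩ := mem_oneLargeBranch.1 hS
  obtain ⟨F', T', hF', -, h⟩ := mem_oneLargeBranch.1 hS'
  have branch_eq : F' ⟨i, Finset.mem_erase.2 ⟨hij, hi⟩⟩ = T := by
    rw [← extend_branches_of_ne F' T', eq_of_graft_eq_graft h hi, extend_branches_self]
  have small : T.size ≤ M := branch_eq ▸ (mem_smallTrees.1 (hF' _)).2
  have large := (mem_treesOfSize.1 hT).2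
  have := sum_size_branches_le hi hF
  have hcard : (T₀.levelFinset r).card * M = ((T₀.levelFinset r).card - 1) * M + M := by
    rw [← Nat.succ_mul, Nat.succ_eq_add_one, Nat.sub_add_cancel (Finset.card_pos.2 ⟨i, hi⟩)]
  omega

theorem graftAt_injective (hi : i ∈ T₀.levelFinset r)
    {F F' : (T₀.levelFinset r).erase i → PlaneTree} {T T' : PlaneTree}
    (h : graftAt T₀ r hr i F T = graftAt T₀ r hr i F' T') : F = F' ∧ T = T' := by
  constructor
  · funext u
    rw [← extend_branches_of_ne F T, eq_of_graft_eq_graft h (Finset.mem_of_mem_erase u.2),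
      extend_branches_of_ne]
  · rw [← extend_branches_self F T, eq_of_graft_eq_graft h hi, extend_branches_self]

theorem le_height_graftAt (hi : i ∈ T₀.levelFinset r)
    {F : (T₀.levelFinset r).erase i → PlaneTree} {T : PlaneTree}
    (hF : ∀ u, (F u).IsFinite) (hT : T.IsFinite) :
    r - 1 + T.height ≤ (graftAt T₀ r hr i F T).height := by
  have := le_height_graft (hr := hr) (fun u _ => isFinite_extend_branches hF hT u) hi
  rwa [extend_branches_self] at this

theorem sum_piFinset_pow_sum_size (hi : i ∈ T₀.levelFinset r) (g : ℝ) :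
    ∑ F ∈ Fintype.piFinset fun _ : (T₀.levelFinset r).erase i => smallTrees M,
        g ^ ∑ u, (F u).size =
      (∑ T ∈ smallTrees M, g ^ T.size) ^ ((T₀.levelFinset r).card - 1) := by
  simp only [← Finset.prod_pow_eq_pow_sum]
  rw [← Finset.card_erase_of_mem hi, ← Fintype.card_coe, ← Finset.card_univ, ← Finset.prod_const,
    Finset.prod_univ_sum]

theorem heightSum_mul_le_sum_oneLargeBranch {k : ℝ} (hk : 1 ≤ k) (hi : i ∈ T₀.levelFinset r)
    (hN : (T₀.innerVerts r).card + (T₀.levelFinset r).card * M < N) :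
    heightSum k N * (k ^ (r - 1) * criticalPoint k ^ (T₀.innerVerts r).card *
      (∑ T ∈ smallTrees M, criticalPoint k ^ T.size) ^ ((T₀.levelFinset r).card - 1)) ≤
    ∑ S ∈ oneLargeBranch T₀ r hr M N i, k ^ S.height := by
  classical
  have hk0 : 0 < k := by linarith
  set n : ((T₀.levelFinset r).erase i → PlaneTree) → ℕ :=
    fun F => (T₀.innerVerts r).card + ∑ u, (F u).size
  have fiber (F) (hF : F ∈ Fintype.piFinset fun _ : (T₀.levelFinset r).erase i => smallTrees M) :
      criticalPoint k ^ n F * heightSum k N ≤ heightSum k (N - n F) := by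
    have hlt : n F < N := by
      have := (sum_size_branches_le hi (Fintype.mem_piFinset.1 hF)).trans
        (Nat.mul_le_mul_right M (Nat.sub_le _ 1))
      simp only [n]
      omega
    have := criticalPoint_pow_mul_heightSum_le hk0 (show 1 ≤ N - n F by omega) (n F)
    rwa [Nat.sub_add_cancel hlt.le] at this
  calc _ = k ^ (r - 1) *
        ∑ F ∈ Fintype.piFinset fun _ : (T₀.levelFinset r).erase i => smallTrees M,
          criticalPoint k ^ n F * heightSum k N := by
        simp only [n, pow_add, ← sum_piFinset_pow_sum_size hi, ← Finset.sum_mul, ← Finset.mul_sum]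
        ring
    _ ≤ k ^ (r - 1) *
        ∑ F ∈ Fintype.piFinset fun _ : (T₀.levelFinset r).erase i => smallTrees M,
          heightSum k (N - n F) :=
        mul_le_mul_of_nonneg_left (Finset.sum_le_sum fiber) (by positivity)
    _ = ∑ x ∈ (Fintype.piFinset fun _ : (T₀.levelFinset r).erase i => smallTrees M).sigma
          fun F => treesOfSize (N - n F), k ^ (r - 1 + x.2.height) := by
        simp only [Finset.sum_sigma, pow_add, ← Finset.mul_sum, heightSum]
    _ ≤ ∑ x ∈ (Fintype.piFinset fun _ : (T₀.levelFinset r).erase i => smallTrees M).sigma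
          fun F => treesOfSize (N - n F), k ^ (graftAt T₀ r hr i x.1 x.2).height := by
        refine Finset.sum_le_sum fun x hx => pow_le_pow_right₀ hk ?_
        have ⟨hF, hT⟩ := Finset.mem_sigma.1 hx
        exact le_height_graftAt hi (fun u => (mem_smallTrees.1 (Fintype.mem_piFinset.1 hF u)).1)
          (mem_treesOfSize.1 hT).1
    _ = ∑ S ∈ oneLargeBranch T₀ r hr M N i, k ^ S.height := by
        rw [oneLargeBranch, Finset.sum_image]
        rintro ⟨F, T⟩ _ ⟨F', T'⟩ _ h
        obtain ⟨rfl, rfl⟩ := graftAt_injective hi h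
        rfl

open Classical in
theorem heightSum_mul_le_sum_closedBall {k : ℝ} (hk : 1 ≤ k) (hr : 1 ≤ r)
    (hN : (T₀.innerVerts r).card + (T₀.levelFinset r).card * M < N) :
    heightSum k N * ((T₀.levelFinset r).card * k ^ (r - 1) *
      criticalPoint k ^ (T₀.innerVerts r).card *
      (∑ T ∈ smallTrees M, criticalPoint k ^ T.size) ^ ((T₀.levelFinset r).card - 1)) ≤
    ∑ T ∈ treesOfSize N with T ∈ Metric.closedBall T₀ (1 / (r : ℝ)), k ^ T.height := by
  calc _ = ∑ _i ∈ T₀.levelFinset r,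
        heightSum k N * (k ^ (r - 1) * criticalPoint k ^ (T₀.innerVerts r).card *
          (∑ T ∈ smallTrees M, criticalPoint k ^ T.size) ^ ((T₀.levelFinset r).card - 1)) := by
        rw [Finset.sum_const, nsmul_eq_mul]
        ring
    _ ≤ ∑ i ∈ T₀.levelFinset r, ∑ S ∈ oneLargeBranch T₀ r hr M N i, k ^ S.height :=
        Finset.sum_le_sum fun i hi => heightSum_mul_le_sum_oneLargeBranch hk hi hN
    _ = ∑ S ∈ (T₀.levelFinset r).biUnion (oneLargeBranch T₀ r hr M N), k ^ S.height :=
        (Finset.sum_biUnion fun i hi j _ hij => disjoint_oneLargeBranch hi hij hN).symm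
    _ ≤ _ := Finset.sum_le_sum_of_subset_of_nonneg (Finset.biUnion_subset.2 fun i hi S hS =>
        Finset.mem_filter.2 (oneLargeBranch_subset hi hN S hS)) fun _ _ _ => by positivity

end OneLargeBranch

/-! ### The offspring probabilities -/

theorem branchingProb_eq {k : ℝ} (hk : 1 < k) (n : ℕ) :
    branchingProb k n = (1 / (1 + k)) ^ n * (1 - 1 / (1 + k)) := by
  rw [branchingProb, treeSeries_criticalPoint hk]

theorem one_div_one_add_lt_one {k : ℝ} (hk : 0 < k) : 1 / (1 + k) < 1 := by
  rw [div_lt_one (by linarith)]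
  linarith

theorem branchingProb_nonneg {k : ℝ} (hk : 1 < k) (n : ℕ) : 0 ≤ branchingProb k n := by
  have := one_div_one_add_lt_one (show 0 < k by linarith)
  rw [branchingProb_eq hk]
  exact mul_nonneg (by positivity) (by linarith)

theorem hasSum_branchingProb {k : ℝ} (hk : 1 < k) : HasSum (branchingProb k) 1 := by
  have hlt := one_div_one_add_lt_one (show 0 < k by linarith)
  have h := (hasSum_geometric_of_lt_one (by positivity) hlt).mul_right (1 - 1 / (1 + k))
  rw [inv_mul_cancel₀ (by linarith)] at h
  exact h.congr_fun (branchingProb_eq hk)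

theorem hasSum_mul_branchingProb {k : ℝ} (hk : 1 < k) :
    HasSum (fun n : ℕ => (n : ℝ) * branchingProb k n) (1 / k) := by
  have hnorm : ‖1 / (1 + k)‖ < 1 := by
    rw [Real.norm_of_nonneg (by positivity)]
    exact one_div_one_add_lt_one (by linarith)
  have h := (hasSum_coe_mul_geometric_of_norm_lt_one hnorm).mul_right (1 - 1 / (1 + k))
  have hk0 : k ≠ 0 := by linarith
  have hk1 : 1 + k ≠ 0 := by linarith
  have hvalue : 1 / (1 + k) / (1 - 1 / (1 + k)) ^ 2 * (1 - 1 / (1 + k)) = 1 / k := by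
    rw [show 1 - 1 / (1 + k) = k / (1 + k) by field_simp; ring]
    field_simp
  rw [hvalue] at h
  exact h.congr_fun fun n => by rw [branchingProb_eq hk, mul_assoc]

theorem meanOffspring_branchingProb {k : ℝ} (hk : 1 < k) :
    meanOffspring (branchingProb k) = 1 / k := (hasSum_mul_branchingProb hk).tsum_eq

theorem isSubcritical_branchingProb {k : ℝ} (hk : 1 < k) : IsSubcritical (branchingProb k) where
  nonneg := branchingProb_nonneg hk
  hasSum_one := hasSum_branchingProb hk
  summable_mean := (hasSum_mul_branchingProb hk).summable
  mean_lt_one := by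
    rwa [meanOffspring_branchingProb hk, div_lt_one (by linarith)]

theorem specialProb_eq (p : ℕ → ℝ) (n : ℕ) : specialProb p n = p (n + 1) / meanOffspring p := by
  have : (n : ℝ) + 1 ≠ 0 := by positivity
  rw [specialProb, sizeBiased, div_right_comm, mul_div_cancel_left₀ _ this]

/-! ### The weights of the marked trees -/

theorem sum_offspring_level (T : PlaneTree) (s : ℕ) :
    ∑ v ∈ T.levelFinset s, T.offspring v = (T.levelFinset (s + 1)).card := by
  rw [← Finset.sum_congr rfl fun v _ => Finset.card_range (T.offspring v), ← Finset.card_sigma]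
  refine Finset.card_bij (fun x _ => x.1 ++ [x.2]) ?_ ?_ ?_
  · rintro ⟨v, i⟩ h
    have ⟨hv, hi⟩ := Finset.mem_sigma.1 h
    exact mem_levelFinset.2 ⟨(append_singleton_mem_iff T v i).2 (Finset.mem_range.1 hi),
      by rw [List.length_append, (mem_levelFinset.1 hv).2, List.length_singleton]⟩
  · rintro ⟨v, i⟩ _ ⟨v', i'⟩ _ h
    obtain ⟨rfl, rfl⟩ := List.append_singleton_inj.1 h
    rfl
  · intro w hw
    have ⟨hw, hl⟩ := mem_levelFinset.1 hw
    obtain rfl | ⟨u, i, rfl⟩ := List.eq_nil_or_concat' w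
    · exact absurd hl (Nat.succ_ne_zero s).symm
    · exact ⟨⟨u, i⟩, Finset.mem_sigma.2 ⟨mem_levelFinset.2 ⟨T.parent_mem u i hw, by simpa using hl⟩,
        Finset.mem_range.2 ((append_singleton_mem_iff T u i).1 hw)⟩, rfl⟩

theorem card_level_one (T : PlaneTree) : (T.levelFinset 1).card = 1 := by
  refine Finset.card_eq_one.2 ⟨[0], Finset.eq_singleton_iff_unique_mem.2
    ⟨mem_levelFinset.2 ⟨T.zero_mem, rfl⟩, fun u hu => ?_⟩⟩
  obtain ⟨j, rfl⟩ := List.length_eq_one_iff.1 (mem_levelFinset.1 hu).2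
  rw [eq_zero_of_cons_mem (mem_levelFinset.1 hu).1]

theorem disjoint_innerVerts_levelFinset (T : PlaneTree) (r : ℕ) :
    Disjoint (T.innerVerts r) (T.levelFinset r) :=
  Finset.disjoint_left.2 fun _ hu hu' =>
    (mem_innerVerts.1 hu).2.2.ne (mem_levelFinset.1 hu').2

theorem innerVerts_succ (T : PlaneTree) {r : ℕ} (hr : 1 ≤ r) :
    T.innerVerts (r + 1) = T.innerVerts r ∪ T.levelFinset r := by
  ext u
  rw [Finset.mem_union, mem_innerVerts, mem_innerVerts, mem_levelFinset]
  grind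

theorem sum_offspring_innerVerts (T : PlaneTree) {r : ℕ} (hr : 1 ≤ r) :
    ∑ v ∈ T.innerVerts r, T.offspring v + 1 = (T.innerVerts r).card + (T.levelFinset r).card := by
  induction r, hr using Nat.le_induction with
  | base => simp [innerVerts, card_level_one]
  | succ r hr ih =>
    have hdisj := T.disjoint_innerVerts_levelFinset r
    rw [innerVerts_succ T hr, Finset.sum_union hdisj, Finset.card_union_of_disjoint hdisj,
      sum_offspring_level]
    omega

theorem mem_of_prefix (T : PlaneTree) {u w : List ℕ} (h : u <+: w) (hw : w ∈ T.carrier) :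
    u ∈ T.carrier := by
  obtain ⟨t, rfl⟩ := h
  exact T.prefix_mem u t hw

theorem innerVerts_filter_prefix {T : PlaneTree} {r : ℕ} {i : List ℕ}
    (hi : i ∈ T.levelFinset r) :
    {v ∈ T.innerVerts r | v <+: i} = (Finset.Ico 1 r).image i.take := by
  have ⟨hi, hir⟩ := mem_levelFinset.1 hi
  ext v
  simp only [Finset.mem_filter, mem_innerVerts, Finset.mem_image, Finset.mem_Ico]
  constructor
  · rintro ⟨⟨-, hv⟩, hvi⟩
    exact ⟨v.length, hv, (List.prefix_iff_eq_take.1 hvi).symm⟩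
  · rintro ⟨s, hs, rfl⟩
    rw [List.length_take_of_le (by omega)]
    exact ⟨⟨T.mem_of_prefix (List.take_prefix s i) hi, hs⟩, List.take_prefix s i⟩

theorem card_innerVerts_filter_prefix {T : PlaneTree} {r : ℕ} {i : List ℕ}
    (hi : i ∈ T.levelFinset r) : {v ∈ T.innerVerts r | v <+: i}.card = r - 1 := by
  have hir := (mem_levelFinset.1 hi).2
  rw [innerVerts_filter_prefix hi, Finset.card_image_of_injOn, Nat.card_Ico]
  intro a ha b hb h
  have ha := (Finset.mem_Ico.1 ha).2
  have hb := (Finset.mem_Ico.1 hb).2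
  have := congrArg List.length h
  rwa [List.length_take_of_le (by omega), List.length_take_of_le (by omega)] at this

theorem exists_append_singleton_prefix {v i : List ℕ} (h : v <+: i) (hl : v.length < i.length) :
    ∃ j, v ++ [j] <+: i := by
  obtain ⟨_ | ⟨j, w⟩, rfl⟩ := h
  · simp at hl
  · exact ⟨j, w, List.append_assoc v [j] w⟩

theorem one_le_offspring_of_prefix {T : PlaneTree} {v i : List ℕ} (hi : i ∈ T.carrier)
    (h : v <+: i) (hl : v.length < i.length) : 1 ≤ T.offspring v := by
  obtain ⟨j, hj⟩ := exists_append_singleton_prefix h hl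
  have := (append_singleton_mem_iff T v j).1 (T.mem_of_prefix hj hi)
  omega

theorem markedWeight_eq (p : ℕ → ℝ) {T₀ : PlaneTree} {i : List ℕ}
    (hi : i ∈ T₀.levelFinset T₀.height) : markedWeight p T₀ i =
      (∏ v ∈ T₀.innerVerts T₀.height, p (T₀.offspring v)) / meanOffspring p ^ (T₀.height - 1) := by
  have ⟨hi₀, hir⟩ := mem_levelFinset.1 hi
  have special : ∏ v ∈ T₀.innerVerts T₀.height with v <+: i,
      specialProb p (T₀.offspring v - 1) =
      ∏ v ∈ T₀.innerVerts T₀.height with v <+: i, p (T₀.offspring v) / meanOffspring p := by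
    refine Finset.prod_congr rfl fun v hv => ?_
    have ⟨hv, hvi⟩ := Finset.mem_filter.1 hv
    have := one_le_offspring_of_prefix hi₀ hvi (by rw [hir]; exact (mem_innerVerts.1 hv).2.2)
    rw [specialProb_eq, Nat.sub_add_cancel this]
  rw [markedWeight, special, Finset.prod_div_distrib, Finset.prod_const,
    card_innerVerts_filter_prefix hi, mul_div_assoc', mul_comm,
    Finset.prod_filter_mul_prod_filter_not]

theorem one_le_card_levelFinset_height {T₀ : PlaneTree} (hf : T₀.IsFinite) :
    1 ≤ (T₀.levelFinset T₀.height).card := by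
  obtain ⟨w, hw, hl⟩ := exists_length_eq_height hf
  exact Finset.card_pos.2 ⟨w, mem_levelFinset.2 ⟨hw, hl⟩⟩

theorem sum_markedWeight_branchingProb {k : ℝ} (hk : 1 < k) {T₀ : PlaneTree} (hf : T₀.IsFinite) :
    ∑ i ∈ T₀.levelFinset T₀.height, markedWeight (branchingProb k) T₀ i =
      (T₀.levelFinset T₀.height).card * k ^ (T₀.height - 1) *
        criticalPoint k ^ (T₀.innerVerts T₀.height).card *
        treeSeries (criticalPoint k) ^ ((T₀.levelFinset T₀.height).card - 1) := by
  have total_offspring : ∑ v ∈ T₀.innerVerts T₀.height, T₀.offspring v =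
      (T₀.innerVerts T₀.height).card + ((T₀.levelFinset T₀.height).card - 1) := by
    have := T₀.sum_offspring_innerVerts (one_le_height hf)
    have := one_le_card_levelFinset_height hf
    omega
  rw [Finset.sum_congr rfl fun i hi => markedWeight_eq _ hi, Finset.sum_const, nsmul_eq_mul]
  simp only [branchingProb_eq hk]
  rw [Finset.prod_mul_distrib, Finset.prod_const, Finset.prod_pow_eq_pow_sum, total_offspring,
    meanOffspring_branchingProb hk, treeSeries_criticalPoint hk, criticalPoint_eq (by linarith),
    mul_pow, pow_add, one_div_pow k, div_div_eq_mul_div, div_one]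
  ring

/-! ### Weak convergence to a law on infinite trees -/

open Classical in
theorem finiteSizeMeasure_apply {μ : ℝ} {N : ℕ} {S : Set PlaneTree} (hS : MeasurableSet S) :
    finiteSizeMeasure μ N S =
      ENNReal.ofReal ((∑ T ∈ treesOfSize N with T ∈ S, Real.exp (-μ) ^ T.height) /
        heightSum (Real.exp (-μ)) N) := by
  rw [Finset.sum_div, Finset.sum_filter, finiteSizeMeasure, Measure.coe_finsetSum, Finset.sum_apply,
    ENNReal.ofReal_sum_of_nonneg]
  · refine Finset.sum_congr rfl fun T _ => ?_
    rw [Measure.smul_apply, Measure.dirac_apply' _ hS, partitionFunction_eq_heightSum, mul_comm,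
      Real.exp_nat_mul]
    by_cases hT : T ∈ S <;> simp [hT]
  · have : 0 ≤ heightSum (Real.exp (-μ)) N := Finset.sum_nonneg fun _ _ => by positivity
    intro T _
    positivity

theorem tendsto_sum_smallTrees {x : ℝ}
    (hx : Summable fun T : {T : PlaneTree // T.IsFinite} => x ^ T.1.size) :
    Tendsto (fun M => ∑ T ∈ smallTrees M, x ^ T.size) atTop (𝓝 (treeSeries x)) := by
  classical
  have exhausts : Tendsto (fun M => (smallTrees M).subtype IsFinite) atTop atTop := by
    refine tendsto_atTop_finset_of_monotone (fun M M' h T hT => ?_) fun T => ⟨T.1.size, ?_⟩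
    · rw [Finset.mem_subtype, mem_smallTrees] at hT ⊢
      exact ⟨hT.1, hT.2.trans h⟩
    · rw [Finset.mem_subtype, mem_smallTrees]
      exact ⟨T.2, le_rfl⟩
  exact (hx.hasSum.comp exhausts).congr fun M =>
    Finset.sum_subtype_of_mem _ fun T hT => (mem_smallTrees.1 hT).1

theorem ofReal_sum_markedWeight_le_liminf {μ : ℝ} (hμ : 1 < Real.exp (-μ)) {T₀ : PlaneTree}
    (hf : T₀.IsFinite) :
    ENNReal.ofReal (∑ i ∈ T₀.levelFinset T₀.height,
        markedWeight (branchingProb (Real.exp (-μ))) T₀ i) ≤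
      liminf (fun N : ℕ+ => finiteSizeMeasure μ N
        (Metric.closedBall T₀ (1 / (T₀.height : ℝ)))) atTop := by
  have series_tendsto :=
    tendsto_sum_smallTrees (summable_criticalPoint_pow_size (Real.exp_pos (-μ)))
  rw [sum_markedWeight_branchingProb hμ hf]
  refine le_of_tendsto' (ENNReal.tendsto_ofReal ((series_tendsto.pow _).const_mul _)) fun M => ?_
  refine le_liminf_of_le (by isBoundedDefault) ?_
  filter_upwards [eventually_ge_atTop (Nat.succPNat ((T₀.innerVerts T₀.height).card +
    (T₀.levelFinset T₀.height).card * M))] with N hN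
  rw [finiteSizeMeasure_apply Metric.isClosed_closedBall.measurableSet]
  refine ENNReal.ofReal_le_ofReal ?_
  rw [le_div_iff₀' (heightSum_pos (Real.exp_pos _) N.pos)]
  exact heightSum_mul_le_sum_closedBall hμ.le (one_le_height hf) (Nat.succ_le_iff.1 hN)

theorem exists_mem_length_eq {T : PlaneTree} (hT : ¬ T.IsFinite) (r : ℕ) :
    ∃ u ∈ T.carrier, u.length = r := by
  by_contra! no_vertex
  refine hT (((Finset.range r).finite_toSet.biUnion fun s _ => T.level_finite s).subset ?_)
  intro u hu
  simp only [Finset.coe_range, Set.mem_Iio, Set.mem_iUnion, exists_prop]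
  refine ⟨u.length, ?_, hu, rfl⟩
  by_contra! hr
  exact no_vertex (u.take r) (T.mem_of_prefix (List.take_prefix _ _) hu)
    (List.length_take_of_le hr)

theorem exists_isFinite_ballVerts_eq (T : PlaneTree) {r : ℕ} (hr : 1 ≤ r) :
    ∃ T₀ : PlaneTree, T₀.IsFinite ∧ T₀.height ≤ r ∧ T₀.ballVerts r = T.ballVerts r := by
  have hf : (graft T r hr fun _ => edge).IsFinite := isFinite_graft fun _ _ => isFinite_edge
  refine ⟨_, hf, (height_le_iff hf).2 fun w hw => ?_, ballVerts_graft⟩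
  by_contra! hlt
  rw [← List.take_append_drop r w,
    append_mem_graft_iff (List.length_take_of_le hlt.le), aboveRoot_edge] at hw
  have : w.drop r = [] := hw.2
  rw [List.drop_eq_nil_iff] at this
  omega

theorem exists_height_eq_ballVerts_eq {T : PlaneTree} (hT : ¬ T.IsFinite) {r : ℕ} (hr : 1 ≤ r) :
    ∃ T₀ : PlaneTree, T₀.IsFinite ∧ T₀.height = r ∧ T₀.ballVerts r = T.ballVerts r := by
  obtain ⟨T₀, hf, hle, hball⟩ := T.exists_isFinite_ballVerts_eq hr
  obtain ⟨u, hu, hur⟩ := exists_mem_length_eq hT r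
  have hu₀ : u ∈ T₀.ballVerts r := hball ▸ ⟨hu, hur.le⟩
  exact ⟨T₀, hf, hle.antisymm (hur ▸ length_le_height hf hu₀.1), hball⟩

theorem closedBall_congr {T T' : PlaneTree} {r : ℕ} (hr : 1 ≤ r)
    (h : T.ballVerts r = T'.ballVerts r) :
    Metric.closedBall T (1 / (r : ℝ)) = Metric.closedBall T' (1 / (r : ℝ)) := by
  ext S
  rw [mem_closedBall_iff hr, mem_closedBall_iff hr, h]

theorem exists_closedBall_subset {U : Set PlaneTree} (hU : IsOpen U) {T : PlaneTree}
    (hT : T ∈ U) : ∃ r : ℕ, 1 ≤ r ∧ Metric.closedBall T (1 / (r : ℝ)) ⊆ U := by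
  obtain ⟨ε, hε, ball_subset⟩ := Metric.isOpen_iff.1 hU T hT
  obtain ⟨n, hn⟩ := exists_nat_one_div_lt hε
  exact ⟨n + 1, by omega, (Metric.closedBall_subset_ball (by exact_mod_cast hn)).trans ball_subset⟩

theorem ballVerts_height {T : PlaneTree} (hf : T.IsFinite) : T.ballVerts T.height = T.carrier :=
  Set.sep_eq_self_iff_mem_true.2 fun _ hu => length_le_height hf hu

theorem countable_setOf_isFinite : {T : PlaneTree | T.IsFinite}.Countable :=
  Set.MapsTo.countable_of_injOn (f := carrier) (t := {s : Set (List ℕ) | s.Finite}) (fun _ hT => hT)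
    (fun _ _ _ _ => PlaneTree.ext) Set.Countable.ofPred_finite

/-- The finite trees `T₀` whose ball of radius `1 / h(T₀)` is contained in `U`, while no larger ball
`1 / r` around `T₀` is. These balls are disjoint and cover the infinite trees in an open `U`. -/
def maximalBallCenters (U : Set PlaneTree) : Set PlaneTree :=
  {T₀ | T₀.IsFinite ∧ Metric.closedBall T₀ (1 / (T₀.height : ℝ)) ⊆ U ∧
    ∀ r : ℕ, 1 ≤ r → r < T₀.height → ¬ Metric.closedBall T₀ (1 / (r : ℝ)) ⊆ U}

section MaximalBalls

variable {U : Set PlaneTree} {T T₀ T₁ : PlaneTree}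

theorem eq_of_mem_closedBall_maximalBallCenters (h₀ : T₀ ∈ maximalBallCenters U)
    (h₁ : T₁ ∈ maximalBallCenters U) (hle : T₀.height ≤ T₁.height)
    (hT₀ : T ∈ Metric.closedBall T₀ (1 / (T₀.height : ℝ)))
    (hT₁ : T ∈ Metric.closedBall T₁ (1 / (T₁.height : ℝ))) : T₀ = T₁ := by
  have hr := one_le_height h₀.1
  rw [mem_closedBall_iff hr] at hT₀
  rw [mem_closedBall_iff (one_le_height h₁.1)] at hT₁
  have same_ball : T₀.ballVerts T₀.height = T₁.ballVerts T₀.height :=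
    hT₀.symm.trans (ballVerts_mono_eq hT₁ hle)
  rcases hle.eq_or_lt with heq | hlt
  · refine PlaneTree.ext ?_
    rw [← ballVerts_height h₀.1, same_ball, heq, ballVerts_height h₁.1]
  · exact absurd (closedBall_congr hr same_ball ▸ h₀.2.1) (h₁.2.2 _ hr hlt)

theorem pairwise_disjoint_maximalBalls (U : Set PlaneTree) : Pairwise (Function.onFun Disjoint
    fun T₀ : maximalBallCenters U => Metric.closedBall T₀.1 (1 / (T₀.1.height : ℝ))) := by
  rintro ⟨T₀, h₀⟩ ⟨T₁, h₁⟩ hne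
  refine Set.disjoint_left.2 fun T hT₀ hT₁ => hne (Subtype.ext ?_)
  rcases le_total T₀.height T₁.height with h | h
  · exact eq_of_mem_closedBall_maximalBallCenters h₀ h₁ h hT₀ hT₁
  · exact (eq_of_mem_closedBall_maximalBallCenters h₁ h₀ h hT₁ hT₀).symm

theorem exists_mem_closedBall_maximalBallCenters (hU : IsOpen U) (hT : ¬ T.IsFinite)
    (hTU : T ∈ U) :
    ∃ T₀ ∈ maximalBallCenters U, T ∈ Metric.closedBall T₀ (1 / (T₀.height : ℝ)) := by
  classical
  have hex := exists_closedBall_subset hU hTU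
  obtain ⟨hr, subset_U⟩ := Nat.find_spec hex
  obtain ⟨T₀, hf, hT₀, hball⟩ := exists_height_eq_ballVerts_eq hT hr
  rw [← hT₀] at hr subset_U hball
  refine ⟨T₀, ⟨hf, (closedBall_congr hr hball).trans_subset subset_U, fun s hs hlt hsub => ?_⟩,
    (mem_closedBall_iff hr).2 hball.symm⟩
  exact Nat.find_min hex (hT₀ ▸ hlt)
    ⟨hs, closedBall_congr hs (ballVerts_mono_eq hball hlt.le) ▸ hsub⟩

end MaximalBalls

theorem tendsto_of_le_liminf_closedBall {ι : Type*} {L : Filter ι} [L.IsCountablyGenerated]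
    {ν : ProbabilityMeasure PlaneTree} {νs : ι → ProbabilityMeasure PlaneTree}
    (hν : ∀ᵐ T ∂(ν : Measure PlaneTree), ¬ T.IsFinite)
    (h : ∀ T₀ : PlaneTree, T₀.IsFinite →
      (ν : Measure PlaneTree) (Metric.closedBall T₀ (1 / (T₀.height : ℝ))) ≤
        L.liminf fun i => (νs i : Measure PlaneTree)
          (Metric.closedBall T₀ (1 / (T₀.height : ℝ)))) :
    Tendsto νs L (𝓝 ν) := by
  refine tendsto_of_forall_isOpen_le_liminf' fun U hU => ?_
  have : Countable (maximalBallCenters U) :=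
    (countable_setOf_isFinite.mono fun _ hT => hT.1).to_subtype
  let B : maximalBallCenters U → Set PlaneTree :=
    fun T₀ => Metric.closedBall T₀.1 (1 / (T₀.1.height : ℝ))
  calc (ν : Measure PlaneTree) U
    _ ≤ (ν : Measure PlaneTree) (⋃ T₀, B T₀) := by
        refine measure_mono_ae ?_
        filter_upwards [hν] with T hT hTU
        obtain ⟨T₀, h₀, hT₀⟩ := exists_mem_closedBall_maximalBallCenters hU hT hTU
        exact Set.mem_iUnion.2 ⟨⟨T₀, h₀⟩, hT₀⟩
    _ ≤ ∑' T₀, (ν : Measure PlaneTree) (B T₀) := measure_iUnion_le B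
    _ ≤ ∑' T₀, L.liminf fun i => (νs i : Measure PlaneTree) (B T₀) :=
        ENNReal.tsum_le_tsum fun T₀ => h T₀.1 T₀.2.1
    _ ≤ L.liminf fun i => ∑' T₀, (νs i : Measure PlaneTree) (B T₀) := by
        simp_rw [← lintegral_count]
        exact lintegral_liminf_le fun _ => measurable_of_countable _
    _ ≤ L.liminf fun i => (νs i : Measure PlaneTree) U := by
        refine liminf_le_liminf (Eventually.of_forall fun i => ?_)
        rw [← measure_iUnion (pairwise_disjoint_maximalBalls U)
          fun T₀ => Metric.isClosed_closedBall.measurableSet]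
        exact measure_mono (Set.iUnion_subset fun T₀ => T₀.2.2.1)

theorem IsKestenLaw.measure_closedBall {p : ℕ → ℝ} {ν : ProbabilityMeasure PlaneTree}
    (hν : IsKestenLaw p ν) {T₀ : PlaneTree} (hf : T₀.IsFinite) :
    (ν : Measure PlaneTree) (Metric.closedBall T₀ (1 / (T₀.height : ℝ))) =
      ENNReal.ofReal (∑ i ∈ T₀.levelFinset T₀.height, markedWeight p T₀ i) := by
  rw [← hν.measure_ball T₀ hf, ofReal_measureReal]

theorem IsKestenLaw.unique {p : ℕ → ℝ} {ν ν' : ProbabilityMeasure PlaneTree}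
    (hν : IsKestenLaw p ν) (hν' : IsKestenLaw p ν') : ν = ν' := by
  have : Tendsto (fun _ : ℕ => ν') atTop (𝓝 ν) :=
    tendsto_of_le_liminf_closedBall hν.ae_infinite fun T₀ hf => by
      rw [liminf_const, hν.measure_closedBall hf, hν'.measure_closedBall hf]
  exact tendsto_nhds_unique this tendsto_const_nhds

theorem tendsto_finiteSizeLaw {μ : ℝ} (hμ : 1 < Real.exp (-μ)) {ν : ProbabilityMeasure PlaneTree}
    (hν : IsKestenLaw (branchingProb (Real.exp (-μ))) ν) :
    Tendsto (finiteSizeLaw μ) atTop (𝓝 ν) :=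
  tendsto_of_le_liminf_closedBall hν.ae_infinite fun _ hf =>
    (hν.measure_closedBall hf).trans_le (ofReal_sum_markedWeight_le_liminf hμ hf)

/-! ### Measurability -/

theorem ballVerts_eq_iff_forall_mem {T T' : PlaneTree} {r : ℕ} :
    T.ballVerts r = T'.ballVerts r ↔
      ∀ w : List ℕ, w.length ≤ r → (w ∈ T.carrier ↔ w ∈ T'.carrier) := by
  simp only [Set.ext_iff, ballVerts, Set.mem_ofPred_eq, and_congr_left_iff]

theorem mem_iff_exists_closedBall {U : Set PlaneTree} (hU : IsOpen U) (T : PlaneTree) :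
    T ∈ U ↔ ∃ T₀ : {T : PlaneTree // T.IsFinite}, ∃ r : ℕ, 1 ≤ r ∧
      Metric.closedBall T₀.1 (1 / (r : ℝ)) ⊆ U ∧ T.ballVerts r = T₀.1.ballVerts r := by
  constructor
  · intro hT
    obtain ⟨r, hr, subset_U⟩ := exists_closedBall_subset hU hT
    obtain ⟨T₀, hf, -, hball⟩ := T.exists_isFinite_ballVerts_eq hr
    exact ⟨⟨T₀, hf⟩, r, hr, (closedBall_congr hr hball).trans_subset subset_U, hball.symm⟩
  · rintro ⟨T₀, r, hr, subset_U, hball⟩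
    exact subset_U ((mem_closedBall_iff hr).2 hball)

theorem measurable_of_measurable_mem {Ω : Type*} [MeasurableSpace Ω] {f : Ω → PlaneTree}
    (hf : ∀ w, Measurable fun x => w ∈ (f x).carrier) : Measurable f := by
  have : Countable {T : PlaneTree // T.IsFinite} := countable_setOf_isFinite.to_subtype
  refine measurable_of_isOpen fun U hU => measurableSet_setOfPred.2 ?_
  simp only [mem_iff_exists_closedBall hU, ballVerts_eq_iff_forall_mem]
  exact .exists fun T₀ => .exists fun r => measurable_const.and <| measurable_const.and <|
    .forall fun w => measurable_const.imp <| (hf w).iff measurable_const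

theorem measurable_mem (w : List ℕ) : Measurable fun T : PlaneTree => w ∈ T.carrier := by
  refine measurableSet_setOfPred.1 (IsOpen.measurableSet (Metric.isOpen_iff.2 fun T hT => ?_))
  refine ⟨1 / ((w.length + 1 : ℕ) : ℝ), by positivity, fun T' hT' => ?_⟩
  have same_ball := ballVerts_eq_of_dist_lt (by omega) hT'
  exact (ballVerts_eq_iff_forall_mem.1 same_ball w (Nat.le_succ _)).2 hT

theorem isInfiniteType_iff {T : PlaneTree} {u : List ℕ} :
    T.IsInfiniteType u ↔ ∀ F : Finset (List ℕ), ∃ w ∉ F, w ∈ T.carrier ∧ u <+: w := by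
  refine ⟨fun h F => ?_, fun h hfin => ?_⟩
  · obtain ⟨w, hw, hwF⟩ := Set.Infinite.exists_notMem_finset h F
    exact ⟨w, hwF, hw⟩
  · obtain ⟨w, hwF, hw⟩ := h hfin.toFinset
    exact hwF (hfin.mem_toFinset.2 hw)

theorem measurable_isInfiniteType (u : List ℕ) :
    Measurable fun T : PlaneTree => T.IsInfiniteType u := by
  simp only [isInfiniteType_iff]
  exact .forall fun F => .exists fun w =>
    measurable_const.and ((measurable_mem w).and measurable_const)

theorem measurableSet_hasSingleSpine : MeasurableSet {T : PlaneTree | T.HasSingleSpine} := by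
  have isSpineVertex (r : ℕ) (u : List ℕ) :
      Measurable fun T : PlaneTree => u ∈ T.level r ∧ T.IsInfiniteType u :=
    ((measurable_mem u).and measurable_const).and (measurable_isInfiniteType u)
  exact measurableSet_setOfPred.2 <| .forall fun r => .exists fun u =>
    (isSpineVertex r u).and (.forall fun y => (isSpineVertex r y).imp measurable_const)

/-! ### Kesten's tree as a function of independent variables -/

/-- The variables `(n, l, r)` attached to a vertex: its number `n` of offspring if it is normal, and
its numbers `l` and `r` of offspring to the left and right of the special one if it is special. -/
abbrev SiteVar : Type := ℕ × ℕ × ℕ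

/-- The position of the special offspring of `v`, if `v` is special; the root has one offspring. -/
def spineChild (ω : List ℕ → SiteVar) (v : List ℕ) : ℕ := if v = [] then 0 else (ω v).2.1

/-- The special vertex at height `n`. -/
def spine (ω : List ℕ → SiteVar) : ℕ → List ℕ
  | 0 => []
  | n + 1 => spine ω n ++ [spineChild ω (spine ω n)]

open Classical in
/-- The offspring numbers of Kesten's tree. -/
def kestenOffspring (ω : List ℕ → SiteVar) (v : List ℕ) : ℕ :=
  if v = [] then 1
  else if spine ω v.length = v then (ω v).2.1 + (ω v).2.2 + 1 else (ω v).1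

theorem kestenOffspring_nil (ω : List ℕ → SiteVar) : kestenOffspring ω [] = 1 := if_pos rfl

/-- Kesten's tree as a function of the variables attached to all possible vertices. -/
def kestenTree (ω : List ℕ → SiteVar) : PlaneTree :=
  ofOffspring (kestenOffspring ω) (kestenOffspring_nil ω)

section Spine

variable (ω : List ℕ → SiteVar)

theorem length_spine (n : ℕ) : (spine ω n).length = n := by
  induction n with
  | zero => rfl
  | succ n ih => rw [spine, List.length_append, ih, List.length_singleton]

theorem take_spine {n m : ℕ} (h : n ≤ m) : (spine ω m).take n = spine ω n := by
  induction m, h using Nat.le_induction with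
  | base => exact List.take_of_length_le (length_spine ω n).le
  | succ m h ih =>
    rw [spine, List.take_append_of_le_length (h.trans (length_spine ω m).ge), ih]

theorem spine_prefix_spine {n m : ℕ} (h : n ≤ m) : spine ω n <+: spine ω m :=
  take_spine ω h ▸ List.take_prefix _ _

theorem prefix_spine_iff {v : List ℕ} {n : ℕ} (hv : v.length ≤ n) :
    v <+: spine ω n ↔ spine ω v.length = v := by
  rw [List.prefix_iff_eq_take, take_spine ω hv, eq_comm]

theorem spine_injective : Function.Injective (spine ω) := fun n m h => by
  rw [← length_spine ω n, h, length_spine]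

theorem spine_mem_kestenTree (n : ℕ) : spine ω n ∈ (kestenTree ω).carrier := by
  induction n with
  | zero => exact (kestenTree ω).nil_mem
  | succ n ih =>
    rw [spine, kestenTree, mem_ofOffspring, inTree_append_singleton]
    refine ⟨ih, ?_⟩
    rw [spineChild, kestenOffspring, length_spine, if_pos rfl]
    split_ifs <;> omega

theorem not_isFinite_kestenTree : ¬ (kestenTree ω).IsFinite :=
  Set.infinite_of_injective_forall_mem (spine_injective ω) (spine_mem_kestenTree ω)

end Spine

theorem measurable_spine_eq (n : ℕ) (u : List ℕ) :
    Measurable fun ω : List ℕ → SiteVar => spine ω n = u := by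
  induction n generalizing u with
  | zero => exact measurable_const (a := [] = u)
  | succ n ih =>
    have spine_succ_eq_iff (ω : List ℕ → SiteVar) : spine ω (n + 1) = u ↔
        ∃ v, spine ω n = v ∧ v ++ [if v = [] then 0 else (ω v).2.1] = u :=
      ⟨fun h => ⟨_, rfl, h⟩, by rintro ⟨v, rfl, h⟩; exact h⟩
    simp only [spine_succ_eq_iff]
    exact .exists fun v => (ih v).and <|
      (Measurable.of_discrete (f := fun x : SiteVar => v ++ [if v = [] then 0 else x.2.1] = u)).comp
        (measurable_pi_apply v)

theorem measurable_kestenOffspring (v : List ℕ) :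
    Measurable fun ω : List ℕ → SiteVar => kestenOffspring ω v := by
  have site_measurable (g : SiteVar → ℕ) : Measurable fun ω : List ℕ → SiteVar => g (ω v) :=
    (Measurable.of_discrete (f := g)).comp (measurable_pi_apply v)
  unfold kestenOffspring
  split_ifs
  · exact measurable_const
  · exact Measurable.ite (measurableSet_setOfPred.2 (measurable_spine_eq _ _))
      (site_measurable fun x => x.2.1 + x.2.2 + 1) (site_measurable fun x => x.1)

theorem measurable_kestenTree : Measurable kestenTree := by
  refine measurable_of_measurable_mem fun w => ?_
  simp only [kestenTree, mem_ofOffspring]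
  induction w using List.reverseRecOn with
  | nil => exact measurable_const (a := True)
  | append_singleton w i ih =>
    simp only [inTree_append_singleton]
    exact ih.and <|
      (Measurable.of_discrete (f := fun n => i < n)).comp (measurable_kestenOffspring w)

theorem ballVerts_ofOffspring_eq_iff {o : List ℕ → ℕ} {ho : o [] = 1} {T : PlaneTree} {r : ℕ} :
    (ofOffspring o ho).ballVerts r = T.ballVerts r ↔
      ∀ v ∈ T.carrier, v.length < r → o v = T.offspring v := by
  constructor
  · intro h v hv hvr
    have hv' : v ∈ (ofOffspring o ho).ballVerts r := h ▸ ⟨hv, hvr.le⟩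
    rw [← (ballVerts_eq_iff _ _ _).1 h v hv hvr, offspring_ofOffspring hv'.1]
  · intro h
    refine (ballVerts_eq_iff _ _ _).2 fun v hv hvr => ?_
    rw [offspring_ofOffspring, h v hv hvr]
    exact ((mem_iff_inTree T v).1 hv).congr fun u hlt hu =>
      (h u ((mem_iff_inTree T u).2 hu) (hlt.trans hvr)).symm

/-- The values of the variables at `v` for which `v` has the same offspring as in `T₀` if the path
to `i` consists of special vertices. -/
def markedBox (T₀ : PlaneTree) (i v : List ℕ) : Set SiteVar :=
  if v <+: i then {x | v ++ [x.2.1] <+: i ∧ x.2.1 + x.2.2 + 1 = T₀.offspring v}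
  else {x | x.1 = T₀.offspring v}

section MarkedBox

variable {T₀ : PlaneTree} {r : ℕ} {i : List ℕ} {ω : List ℕ → SiteVar}

theorem append_spineChild_prefix (hi : i ∈ T₀.levelFinset r)
    (hω : ω ∈ (T₀.innerVerts r : Set (List ℕ)).pi (markedBox T₀ i)) {v : List ℕ} (hv : v <+: i)
    (hvr : v.length < r) : v ++ [spineChild ω v] <+: i := by
  rw [mem_levelFinset] at hi
  rw [spineChild]
  split_ifs with hnil
  · subst hnil
    obtain ⟨j, hj⟩ := exists_append_singleton_prefix hv (hi.2 ▸ hvr)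
    rwa [← eq_zero_of_cons_mem (T₀.mem_of_prefix hj hi.1)]
  · have hbox := hω v (Finset.mem_coe.2 (mem_innerVerts.2
      ⟨T₀.mem_of_prefix hv hi.1, List.length_pos_of_ne_nil hnil, hvr⟩))
    rw [markedBox, if_pos hv] at hbox
    exact hbox.1

theorem spine_eq_of_mem_markedBox (hi : i ∈ T₀.levelFinset r)
    (hω : ω ∈ (T₀.innerVerts r : Set (List ℕ)).pi (markedBox T₀ i)) : spine ω r = i := by
  suffices ∀ n ≤ r, spine ω n <+: i from
    (this r le_rfl).eq_of_length ((length_spine ω r).trans (mem_levelFinset.1 hi).2.symm)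
  intro n hn
  induction n with
  | zero => exact List.nil_prefix
  | succ n ih =>
    exact append_spineChild_prefix hi hω (ih (by omega)) (by rw [length_spine]; omega)

theorem mem_markedBox_of_ballVerts_eq (h : (kestenTree ω).ballVerts r = T₀.ballVerts r) :
    ω ∈ (T₀.innerVerts r : Set (List ℕ)).pi (markedBox T₀ (spine ω r)) := by
  intro v hv
  rw [Finset.mem_coe, mem_innerVerts] at hv
  have hne : v ≠ [] := List.ne_nil_of_length_pos hv.2.1
  have same_offspring := ballVerts_ofOffspring_eq_iff.1 h v hv.1 hv.2.2
  rw [kestenOffspring, if_neg hne] at same_offspring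
  simp only [markedBox, prefix_spine_iff ω hv.2.2.le]
  split_ifs at same_offspring ⊢ with hspine
  · refine ⟨?_, same_offspring⟩
    have := spine_prefix_spine ω (Nat.succ_le_of_lt hv.2.2)
    rwa [spine, hspine, spineChild, if_neg hne] at this
  · exact same_offspring

theorem ballVerts_kestenTree_of_mem_markedBox (hi : i ∈ T₀.levelFinset r)
    (hω : ω ∈ (T₀.innerVerts r : Set (List ℕ)).pi (markedBox T₀ i)) :
    (kestenTree ω).ballVerts r = T₀.ballVerts r := by
  obtain rfl := spine_eq_of_mem_markedBox hi hω
  refine ballVerts_ofOffspring_eq_iff.2 fun v hv hvr => ?_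
  rw [kestenOffspring]
  split_ifs with hnil hspine
  · rw [hnil, offspring_nil]
  all_goals
    have hbox := hω v (Finset.mem_coe.2 (mem_innerVerts.2
      ⟨hv, List.length_pos_of_ne_nil hnil, hvr⟩))
    simp only [markedBox, prefix_spine_iff ω hvr.le] at hbox
  · rw [if_pos hspine] at hbox
    exact hbox.2
  · rwa [if_neg hspine] at hbox

end MarkedBox

theorem preimage_kestenTree_closedBall (T₀ : PlaneTree) {r : ℕ} (hr : 1 ≤ r) :
    kestenTree ⁻¹' Metric.closedBall T₀ (1 / (r : ℝ)) =
      ⋃ i ∈ T₀.levelFinset r, (T₀.innerVerts r : Set (List ℕ)).pi (markedBox T₀ i) := by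
  ext ω
  rw [Set.mem_preimage, mem_closedBall_iff hr, Set.mem_iUnion₂]
  refine ⟨fun h => ?_, fun ⟨i, hi, hω⟩ => ballVerts_kestenTree_of_mem_markedBox hi hω⟩
  have spine_mem : spine ω r ∈ T₀.ballVerts r :=
    h ▸ ⟨spine_mem_kestenTree ω r, (length_spine ω r).le⟩
  exact ⟨spine ω r, mem_levelFinset.2 ⟨spine_mem.1, length_spine ω r⟩,
    mem_markedBox_of_ballVerts_eq h⟩

theorem pairwiseDisjoint_pi_markedBox (T₀ : PlaneTree) (r : ℕ) :
    (T₀.levelFinset r : Set (List ℕ)).PairwiseDisjoint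
      fun i => (T₀.innerVerts r : Set (List ℕ)).pi (markedBox T₀ i) := fun _ hi _ hj hij =>
  Set.disjoint_left.2 fun _ hωi hωj => hij <|
    (spine_eq_of_mem_markedBox hi hωi).symm.trans (spine_eq_of_mem_markedBox hj hωj)

/-! ### The law of Kesten's tree -/

theorem hasSum_sizeBiased {p : ℕ → ℝ} (hp : Summable fun n : ℕ => (n : ℝ) * p n)
    (hm : meanOffspring p ≠ 0) : HasSum (sizeBiased p) 1 := by
  have h := ((hasSum_nat_add_iff' 1).2 hp.hasSum).div_const (meanOffspring p)
  rw [Finset.sum_range_one, Nat.cast_zero, zero_mul, sub_zero, ← meanOffspring, div_self hm] at h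
  simp only [Nat.cast_add, Nat.cast_one] at h
  exact h

theorem tsum_prod_add (f : ℕ → ENNReal) :
    ∑' x : ℕ × ℕ, f (x.1 + x.2) = ∑' n : ℕ, (n + 1) * f n := by
  rw [← (Finset.HasAntidiagonal.sigmaAntidiagonalEquivProd (A := ℕ)).tsum_eq, ENNReal.tsum_sigma']
  refine tsum_congr fun n => ?_
  calc ∑' x : Finset.HasAntidiagonal.antidiagonal n, f (x.1.1 + x.1.2)
    _ = ∑ x ∈ Finset.HasAntidiagonal.antidiagonal n, f (x.1 + x.2) :=
        Finset.tsum_subtype _ fun x : ℕ × ℕ => f (x.1 + x.2)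
    _ = ∑ _x ∈ Finset.HasAntidiagonal.antidiagonal n, f n :=
        Finset.sum_congr rfl fun x hx => by rw [Finset.HasAntidiagonal.mem_antidiagonal.1 hx]
    _ = (n + 1) * f n := by
        rw [Finset.sum_const, Finset.Nat.card_antidiagonal, nsmul_eq_mul, Nat.cast_succ]

section KestenLaw

variable {p : ℕ → ℝ} (hp : IsSubcritical p) (hm : 0 < meanOffspring p)

/-- The law of the number of offspring of a normal vertex. -/
def offspringPMF : PMF ℕ :=
  ⟨fun n => ENNReal.ofReal (p n), by
    rw [ENNReal.summable.hasSum_iff, ← ENNReal.ofReal_tsum_of_nonneg hp.nonneg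
      hp.hasSum_one.summable, hp.hasSum_one.tsum_eq, ENNReal.ofReal_one]⟩

theorem offspringPMF_apply (n : ℕ) : offspringPMF hp n = ENNReal.ofReal (p n) := rfl

include hp hm in
theorem specialProb_nonneg (n : ℕ) : 0 ≤ specialProb p n := by
  rw [specialProb_eq]
  exact div_nonneg (hp.nonneg _) hm.le

include hp hm in
theorem tsum_ofReal_specialProb :
    ∑' x : ℕ × ℕ, ENNReal.ofReal (specialProb p (x.1 + x.2)) = 1 := by
  have total := hasSum_sizeBiased hp.summable_mean hm.ne'
  have sizeBiased_eq (n : ℕ) : (n + 1) * specialProb p n = sizeBiased p n :=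
    mul_div_cancel₀ _ (by positivity)
  have ofReal_sizeBiased (n : ℕ) :
      (n + 1) * ENNReal.ofReal (specialProb p n) = ENNReal.ofReal (sizeBiased p n) := by
    rw [← sizeBiased_eq, ENNReal.ofReal_mul (by positivity), ENNReal.ofReal_add (by positivity)
      zero_le_one, ENNReal.ofReal_natCast, ENNReal.ofReal_one]
  have sizeBiased_nonneg (n : ℕ) : 0 ≤ sizeBiased p n :=
    sizeBiased_eq n ▸ mul_nonneg (by positivity) (specialProb_nonneg hp hm n)
  rw [tsum_prod_add fun n => ENNReal.ofReal (specialProb p n), tsum_congr ofReal_sizeBiased,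
    ← ENNReal.ofReal_tsum_of_nonneg sizeBiased_nonneg total.summable, total.tsum_eq,
    ENNReal.ofReal_one]

/-- The law of the numbers of left and right siblings of the special offspring of a special
vertex. -/
def specialPMF : PMF (ℕ × ℕ) :=
  ⟨fun x => ENNReal.ofReal (specialProb p (x.1 + x.2)),
    ENNReal.summable.hasSum_iff.2 (tsum_ofReal_specialProb hp hm)⟩

theorem specialPMF_apply (x : ℕ × ℕ) :
    specialPMF hp hm x = ENNReal.ofReal (specialProb p (x.1 + x.2)) := rfl

/-- The law of the variables attached to a vertex. -/
def siteLaw : Measure SiteVar := (offspringPMF hp).toMeasure.prod (specialPMF hp hm).toMeasure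

instance : IsProbabilityMeasure (siteLaw hp hm) :=
  inferInstanceAs (IsProbabilityMeasure (Measure.prod _ _))

/-- The law of a family of independent variables attached to all possible vertices. -/
def sitesLaw : Measure (List ℕ → SiteVar) := Measure.infinitePi fun _ => siteLaw hp hm

instance : IsProbabilityMeasure (sitesLaw hp hm) :=
  inferInstanceAs (IsProbabilityMeasure (Measure.infinitePi _))

theorem siteLaw_preimage_fst (s : Set ℕ) :
    siteLaw hp hm (Prod.fst ⁻¹' s) = (offspringPMF hp).toMeasure s :=
  measurePreserving_fst.measure_preimage MeasurableSet.of_discrete.nullMeasurableSet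

theorem siteLaw_preimage_snd (s : Set (ℕ × ℕ)) :
    siteLaw hp hm (Prod.snd ⁻¹' s) = (specialPMF hp hm).toMeasure s :=
  measurePreserving_snd.measure_preimage MeasurableSet.of_discrete.nullMeasurableSet

theorem markedBox_eq_of_prefix {T₀ : PlaneTree} {i v : List ℕ} (hi : i ∈ T₀.carrier) {j : ℕ}
    (hj : v ++ [j] <+: i) :
    markedBox T₀ i v = Prod.snd ⁻¹' {(j, T₀.offspring v - 1 - j)} := by
  have hlt := (append_singleton_mem_iff T₀ v j).1 (T₀.mem_of_prefix hj hi)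
  rw [markedBox, if_pos ((List.prefix_append v [j]).trans hj)]
  ext ⟨n, a, b⟩
  simp only [Set.mem_ofPred_eq, Set.mem_preimage, Set.mem_singleton_iff, Prod.mk.injEq]
  constructor
  · rintro ⟨ha, hab⟩
    have : v ++ [a] = v ++ [j] :=
      (List.prefix_of_prefix_length_le ha hj (by simp)).eq_of_length (by simp)
    obtain rfl := List.singleton_inj.1 (List.append_cancel_left this)
    exact ⟨rfl, by omega⟩
  · rintro ⟨rfl, rfl⟩
    exact ⟨hj, by omega⟩

theorem siteLaw_markedBox {T₀ : PlaneTree} {r : ℕ} {i v : List ℕ} (hi : i ∈ T₀.levelFinset r)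
    (hv : v ∈ T₀.innerVerts r) :
    siteLaw hp hm (markedBox T₀ i v) = ENNReal.ofReal
      (if v <+: i then specialProb p (T₀.offspring v - 1) else p (T₀.offspring v)) := by
  have ⟨hi₀, hir⟩ := mem_levelFinset.1 hi
  split_ifs with hpre
  · obtain ⟨j, hj⟩ := exists_append_singleton_prefix hpre (hir ▸ (mem_innerVerts.1 hv).2.2)
    have hlt := (append_singleton_mem_iff T₀ v j).1 (T₀.mem_of_prefix hj hi₀)
    rw [markedBox_eq_of_prefix hi₀ hj, siteLaw_preimage_snd,
      PMF.toMeasure_apply_singleton _ _ .of_discrete, specialPMF_apply,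
      show j + (T₀.offspring v - 1 - j) = T₀.offspring v - 1 by omega]
  · rw [markedBox, if_neg hpre]
    exact (siteLaw_preimage_fst hp hm {T₀.offspring v}).trans <|
      PMF.toMeasure_apply_singleton _ _ .of_discrete

theorem sitesLaw_pi_markedBox {T₀ : PlaneTree} {i : List ℕ}
    (hi : i ∈ T₀.levelFinset T₀.height) :
    (sitesLaw hp hm).real ((T₀.innerVerts T₀.height : Set (List ℕ)).pi (markedBox T₀ i)) =
      markedWeight p T₀ i := by
  rw [measureReal_def, sitesLaw, Measure.infinitePi_pi _ fun _ _ => .of_discrete,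
    ENNReal.toReal_prod, markedWeight, mul_comm, ← Finset.prod_ite]
  refine Finset.prod_congr rfl fun v hv => ?_
  rw [siteLaw_markedBox hp hm hi hv, ENNReal.toReal_ofReal]
  split_ifs
  exacts [specialProb_nonneg hp hm _, hp.nonneg _]

/-- The law of Kesten's tree. -/
def kestenLaw : ProbabilityMeasure PlaneTree :=
  ⟨(sitesLaw hp hm).map kestenTree,
    Measure.isProbabilityMeasure_map measurable_kestenTree.aemeasurable⟩

theorem coe_kestenLaw : (kestenLaw hp hm : Measure PlaneTree) = (sitesLaw hp hm).map kestenTree :=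
  rfl

theorem isKestenLaw_kestenLaw : IsKestenLaw p (kestenLaw hp hm) where
  ae_infinite := by
    rw [coe_kestenLaw]
    exact (ae_map_iff measurable_kestenTree.aemeasurable
      countable_setOf_isFinite.measurableSet.compl).2 (Eventually.of_forall not_isFinite_kestenTree)
  measure_ball T₀ hf := by
    rw [coe_kestenLaw, map_measureReal_apply measurable_kestenTree
      Metric.isClosed_closedBall.measurableSet,
      preimage_kestenTree_closedBall T₀ (one_le_height hf),
      measureReal_biUnion_finset (pairwiseDisjoint_pi_markedBox T₀ _) fun i _ =>
        .pi (Finset.countable_toSet _) fun _ _ => .of_discrete]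
    exact Finset.sum_congr rfl fun i hi => sitesLaw_pi_markedBox hp hm hi

end KestenLaw

/-! ### The single spine of Kesten's tree -/

theorem tsum_fin_prod (h : ℕ → ENNReal) (n : ℕ) :
    ∑' f : Fin n → ℕ, ∏ i, h (f i) = (∑' j, h j) ^ n := by
  induction n with
  | zero => simp
  | succ n ih =>
    rw [← (Fin.consEquiv fun _ => ℕ).tsum_eq, ENNReal.tsum_prod']
    simp only [Fin.consEquiv_apply, Fin.prod_univ_succ, Fin.cons_zero, Fin.cons_succ,
      ENNReal.tsum_mul_left]
    rw [ih, ENNReal.tsum_mul_right, pow_succ']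

theorem tsum_list_prod (h : ℕ → ENNReal) :
    ∑' v : List ℕ, ∏ i : Fin v.length, h (v.get i) = ∑' n : ℕ, (∑' j, h j) ^ n := by
  calc ∑' v : List ℕ, ∏ i : Fin v.length, h (v.get i)
    _ = ∑' s : Σ n, Fin n → ℕ, ∏ i, h (s.2 i) :=
        List.equivSigmaTuple.tsum_eq fun s : Σ n, Fin n → ℕ => ∏ i, h (s.2 i)
    _ = ∑' n : ℕ, ∑' f : Fin n → ℕ, ∏ i, h (f i) := ENNReal.tsum_sigma' _
    _ = ∑' n : ℕ, (∑' j, h j) ^ n := tsum_congr (tsum_fin_prod h)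

theorem tsum_measure_setOf_lt (ρ : Measure ℕ) : ∑' j : ℕ, ρ {n | j < n} = ∫⁻ n, n ∂ρ := by
  have tsum_indicator (n : ℕ) : ∑' j : ℕ, {m | j < m}.indicator (1 : ℕ → ENNReal) n = n := by
    have indicator_eq (j : ℕ) : {m | j < m}.indicator (1 : ℕ → ENNReal) n =
        (Finset.range n : Set ℕ).indicator 1 j := by
      simp only [Set.indicator_apply, Set.mem_ofPred_eq, Pi.one_apply, Finset.mem_coe,
        Finset.mem_range]
    rw [tsum_congr indicator_eq, ← sum_eq_tsum_indicator, Pi.one_def, Finset.sum_const,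
      Finset.card_range, nsmul_one]
  simp_rw [← tsum_indicator]
  rw [lintegral_tsum fun j => Measurable.of_discrete.aemeasurable]
  exact tsum_congr fun j => (lintegral_indicator_one .of_discrete).symm

theorem inTree_iff_get (o : List ℕ → ℕ) (v : List ℕ) :
    InTree o v ↔ ∀ i : Fin v.length, v.get i < o (v.take i) := by
  induction v generalizing o with
  | nil => simp
  | cons j v ih =>
    rw [inTree_cons, ih]
    simp [Fin.forall_fin_succ]

/-- The descendants of `u`, as words relative to `u`, when `u` and all its descendants are
normal. -/
def normalBranch (ω : List ℕ → SiteVar) (u : List ℕ) : Set (List ℕ) :=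
  {v | InTree (fun x => (ω (u ++ x)).1) v}

theorem not_isInfiniteType_of_finite_normalBranch {ω : List ℕ → SiteVar} {u : List ℕ}
    (hfin : (normalBranch ω u).Finite) (hu : spine ω u.length ≠ u) :
    ¬ (kestenTree ω).IsInfiniteType u := by
  have kestenOffspring_append (x : List ℕ) : kestenOffspring ω (u ++ x) = (ω (u ++ x)).1 := by
    have ne_spine : spine ω (u ++ x).length ≠ u ++ x := fun h => hu <|
      (prefix_spine_iff ω (by simp)).1 (h ▸ List.prefix_append u x)
    have ne_nil : u ++ x ≠ [] := fun h => ne_spine (by rw [h]; rfl)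
    rw [kestenOffspring, if_neg ne_nil, if_neg ne_spine]
  refine Set.not_infinite.2 ((hfin.image (u ++ ·)).subset ?_)
  rintro _ ⟨hw, v, rfl⟩
  have hv := ((inTree_append _ u v).1 (mem_ofOffspring.1 hw)).2
  simp only [kestenOffspring_append] at hv
  exact ⟨v, hv, rfl⟩

theorem hasSingleSpine_kestenTree {ω : List ℕ → SiteVar}
    (hω : ∀ u, (normalBranch ω u).Finite) : (kestenTree ω).HasSingleSpine := by
  refine fun r => ⟨spine ω r, ⟨⟨spine_mem_kestenTree ω r, length_spine ω r⟩, ?_⟩, ?_⟩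
  · exact Set.infinite_of_injective_forall_mem
      ((spine_injective ω).comp (add_right_injective r))
      fun n => ⟨spine_mem_kestenTree ω _, spine_prefix_spine ω (Nat.le_add_right r n)⟩
  · rintro u ⟨⟨-, rfl⟩, hu⟩
    by_contra hne
    exact not_isInfiniteType_of_finite_normalBranch (hω u) (Ne.symm hne) hu

section Subcritical

variable {p : ℕ → ℝ} (hp : IsSubcritical p) (hm : 0 < meanOffspring p)

theorem tsum_offspringPMF_tail :
    ∑' j : ℕ, (offspringPMF hp).toMeasure {n | j < n} = ENNReal.ofReal (meanOffspring p) := by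
  rw [tsum_measure_setOf_lt, lintegral_countable', meanOffspring,
    ENNReal.ofReal_tsum_of_nonneg (fun n => mul_nonneg n.cast_nonneg (hp.nonneg n))
      hp.summable_mean]
  refine tsum_congr fun n => ?_
  rw [PMF.toMeasure_apply_singleton _ _ .of_discrete, offspringPMF_apply,
    ENNReal.ofReal_mul n.cast_nonneg, ENNReal.ofReal_natCast]

theorem sitesLaw_mem_normalBranch (u v : List ℕ) :
    sitesLaw hp hm {ω | v ∈ normalBranch ω u} =
      ∏ i : Fin v.length, (offspringPMF hp).toMeasure {n | v.get i < n} := by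
  have take_injective : Function.Injective fun i : Fin v.length => u ++ v.take i := by
    intro i j h
    have := congrArg List.length (List.append_cancel_left h)
    rw [List.length_take_of_le i.2.le, List.length_take_of_le j.2.le] at this
    exact Fin.ext this
  have independent := (ProbabilityTheory.iIndepFun_infinitePi (P := fun _ => siteLaw hp hm)
    fun _ : List ℕ => measurable_id).precomp take_injective
  have event_eq : {ω : List ℕ → SiteVar | v ∈ normalBranch ω u} =
      ⋂ i : Fin v.length, (fun ω => ω (u ++ v.take i)) ⁻¹' (Prod.fst ⁻¹' {n | v.get i < n}) := by
    ext ω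
    simp only [normalBranch, Set.mem_ofPred_eq, inTree_iff_get, Set.mem_iInter, Set.mem_preimage]
  rw [event_eq]
  refine (independent.meas_iInter fun i => ⟨_, .of_discrete, rfl⟩).trans
    (Finset.prod_congr rfl fun i _ => ?_)
  rw [← siteLaw_preimage_fst hp hm]
  exact (measurePreserving_eval_infinitePi _ _).measure_preimage
    MeasurableSet.of_discrete.nullMeasurableSet

/-- The number of `v` in `normalBranch ω u` has the finite expectation `∑ n, m ^ n`, where `m` is
the average offspring. -/
theorem ae_finite_normalBranch (u : List ℕ) :
    ∀ᵐ ω ∂sitesLaw hp hm, (normalBranch ω u).Finite := by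
  refine ae_finite_setOfPred_mem (s := fun v => {ω | v ∈ normalBranch ω u}) ?_
  simp_rw [sitesLaw_mem_normalBranch]
  rw [tsum_list_prod fun j => (offspringPMF hp).toMeasure {n | j < n}, tsum_offspringPMF_tail,
    ENNReal.tsum_geometric]
  exact ENNReal.inv_ne_top.2 (tsub_pos_of_lt (ENNReal.ofReal_lt_one.2 hp.mean_lt_one)).ne'

theorem ae_hasSingleSpine_kestenLaw :
    ∀ᵐ T ∂(kestenLaw hp hm : Measure PlaneTree), T.HasSingleSpine := by
  rw [coe_kestenLaw]
  refine (ae_map_iff measurable_kestenTree.aemeasurable measurableSet_hasSingleSpine).2 ?_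
  filter_upwards [ae_all_iff.2 (ae_finite_normalBranch hp hm)] with ω hω
  exact hasSingleSpine_kestenTree hω

end Subcritical

end PlaneTree

end

theorem mainTheorem9 (μ k : ℝ) (hμ : μ < 0) (hk : k = Real.exp (-μ)) :
    (Summable fun T : {T : PlaneTree // T.IsFinite} =>
      PlaneTree.criticalPoint k ^ T.1.size) ∧
    PlaneTree.IsSubcritical (PlaneTree.branchingProb k) ∧
    ∃ ν : ProbabilityMeasure PlaneTree,
      Tendsto (fun N : ℕ+ => PlaneTree.finiteSizeLaw μ N) atTop (𝓝 ν) ∧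
      PlaneTree.IsKestenLaw (PlaneTree.branchingProb k) ν ∧
      (∀ ν' : ProbabilityMeasure PlaneTree,
        PlaneTree.IsKestenLaw (PlaneTree.branchingProb k) ν' → ν' = ν) ∧
      ∀ᵐ T ∂(ν : Measure PlaneTree), T.HasSingleSpine := by
  subst hk
  have one_lt : 1 < Real.exp (-μ) := Real.one_lt_exp_iff.2 (neg_pos.2 hμ)
  have subcritical := PlaneTree.isSubcritical_branchingProb one_lt
  have mean_pos : 0 < PlaneTree.meanOffspring (PlaneTree.branchingProb (Real.exp (-μ))) := by
    rw [PlaneTree.meanOffspring_branchingProb one_lt]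
    positivity
  have isKestenLaw := PlaneTree.isKestenLaw_kestenLaw subcritical mean_pos
  exact ⟨PlaneTree.summable_criticalPoint_pow_size (Real.exp_pos _), subcritical,
    PlaneTree.kestenLaw subcritical mean_pos,
    PlaneTree.tendsto_finiteSizeLaw one_lt isKestenLaw, isKestenLaw,
    fun _ h => h.unique isKestenLaw, PlaneTree.ae_hasSingleSpine_kestenLaw subcritical mean_pos⟩
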